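/- **Setting.** Let $\eta=\mathrm{diag}(1,-1,-1,-1)$ and let $\mathcal J$ be the free graded-commutative complex algebra generated by the jet variables $h_{\mu\nu;s}$ (even, $h_{\mu\nu}=h_{\nu\mu}$), $u_{\rho;s}$ and $\tilde u_{\sigma;s}$ (odd), where $s$ runs over the finite multisets of indices in $\{0,1,2,3\}$ (formal derivatives). Let $d_\nu$ be the formal derivative (the derivation adding $\nu$ to $s$; we also write $X_{,\nu}=d_\nu X$), let $h=\eta^{\mu\nu}h_{\mu\nu}$, and let the gauge charge $d_Q$ be the odd graded derivation commuting with all $d_\nu$ such that $$d_Qh_{\mu\nu}=-\tfrac i2\left(d_\mu u_\nu+d_\nu u_\mu-\eta_{\mu\nu}d_\rho u^\rho\right),\qquad d_Qu_\rho=0,\qquad d_Q\tilde u_\sigma=i\,d^\lambda h_{\sigma\lambda}.$$ Write $\simeq$ for equality modulo the ideal generated by the equations of motion $\eta^{\mu\nu}d_\mu d_\nu\xi=0$, $\xi$ any jet variable. The canonical dimension $\omega$ counts one for every field and every derivative. For a variable $\xi$ put $\xi\cdot A=(-1)^{|\xi||A|}\,\partial A/\partial\xi$ (left derivative), normalized by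 $h_{\mu\nu}\cdot h_{\rho\sigma}=\frac12(\eta_{\mu\rho}\eta_{\nu\sigma}+\eta_{\mu\sigma}\eta_{\nu\rho})$, $u_\mu\cdot u_\rho=\tilde u_\mu\cdot\tilde u_\rho=\eta_{\mu\rho}$, with one more factor $\eta$ for a derivative index. The interaction Lagrangian is $$\begin{aligned}T={}&-h_{\alpha\beta}d^\alpha h\,d^\beta h+2h^{\alpha\beta}d_\alpha h_{\mu\nu}d_\beta h^{\mu\nu}+4h_{\alpha\beta}d_\nu h^{\beta\mu}d_\mu h^{\alpha\nu}+2h_{\alpha\beta}d_\mu h^{\alpha\beta}d^\mu h-4h_{\alpha\beta}d_\nu h^{\alpha\mu}d^\nu h^\beta{}_\mu\\&-4u^\mu d_\beta\tilde u_\nu d_\mu h^{\nu\beta}+4d_\nu u^\beta d_\mu\tilde u_\beta h^{\mu\nu}-4d^\nu u_\nu d_\alpha\tilde u_\beta h^{\alpha\beta}+4d_\nu u^\mu d_\mu\tilde u_\beta h^{\nu\beta}.\end{aligned}$$ Put $B_{\mu\nu}=\tilde u_{\mu,\nu}\cdot T$, $C_{\mu\nu}=h_{\mu\nu}\cdot T$,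 $D_\mu=u_\mu\cdot T$, $E_{\mu\nu,\lambda}=h_{\mu\nu,\lambda}\cdot T$, $F_{\mu,\nu}=u_{\mu,\nu}\cdot T$, $B_1^\mu=2u_\sigma d^\sigma u^\mu$. The second-order anomaly is, up to a total divergence, $$\mathcal A'(T,T)=B^{\mu\nu}(C_{\mu\nu}-d^\lambda E_{\mu\nu,\lambda})+2B_1^\mu(D_\mu-d^\lambda F_{\mu,\lambda}),$$ and $\mathcal A_{uhhh}$ denotes its part tri-linear in $h$. Let $$\begin{aligned}\mathcal D={}&2\left(h^{\rho\sigma}{}_{,\sigma}h_{,\rho}+h^{\rho\sigma}h_{,\rho\sigma}-h^{\rho\sigma,\lambda}h_{\rho\sigma,\lambda}\right),\\ \mathcal D_{\mu\nu}={}&-h_{,\mu}h_{,\nu}+2h^{\rho\sigma}{}_{,\mu}h_{\rho\sigma,\nu}+4\left(h_{\mu\rho,\sigma}h_\nu{}^{\sigma,\rho}+h_{\mu\rho,\sigma}h_\nu{}^{\rho,\sigma}\right)-4\left(h^{\rho\sigma}{}_{,\rho}h_{\mu\nu,\sigma}+h^{\rho\sigma}h_{\mu\nu,\rho\sigma}\right)\\&-4\left(h_{\mu\rho,\sigma}h^{\rho\sigma}{}_{,\nu}+h_{\nu\rho,\sigma}h^{\rho\sigma}{}_{,\mu}+h_{\mu\rho}h^{\rho\sigma}{}_{,\nu\sigma}+h_{\nu\rho}h^{\rho\sigma}{}_{,\mu\sigma}\right),\end{aligned}$$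 $$\mathcal A_\rho=4h_{,\rho}\mathcal D+4h_{\mu\nu,\rho}\mathcal D^{\mu\nu},\quad \mathcal A=4h\mathcal D+4h_{\mu\nu}\mathcal D^{\mu\nu},\quad \mathcal A_{\mu\nu}=-8h_{\mu\nu}\mathcal D-8h_\nu{}^\lambda\mathcal D_{\mu\lambda},\quad \tilde{\mathcal A}_\rho=\mathcal A_\rho-d_\rho\mathcal A-d^\sigma\mathcal A_{\rho\sigma}.$$ **Theorem.** Let $N(T,T)=iN_0$ with $$\begin{aligned}N_0={}&-16h^{\mu\nu}h^{\rho\sigma}d_\rho h_{\mu\nu}d_\sigma h+8h^{\mu\nu}h^{\rho\sigma}d_\lambda h_{\mu\nu}d^\lambda h_{\rho\sigma}+32h^{\mu\nu}h_{\nu\rho}d^\alpha h^{\rho\beta}d_\beta h_{\mu\alpha}+32h^{\mu\nu}h^{\rho\sigma}d_\mu h_{\rho\alpha}d_\nu h_\sigma{}^\alpha\\&-32h^{\mu\nu}h_{\nu\rho}d^\alpha h_{\mu\beta}d_\alpha h^{\rho\beta}-16h^{\mu\nu}h^{\rho\sigma}d_\lambda h_{\mu\rho}d^\lambda h_{\nu\sigma}+16h^{\mu\nu}h_\nu{}^\rho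 d^\lambda h_{\mu\rho}d_\lambda h.\end{aligned}$$ 1. $\mathcal A_{uhhh}\simeq u_\rho\mathcal A^\rho+u_{\rho,}{}^\rho\mathcal A+u_{\mu,\nu}\mathcal A^{\mu\nu}$. 2. $N(T,T)$ is quadri-linear in $h$, of ghost number $0$ and canonical dimension $6$. 3. The finite renormalization by $N(T,T)$ removes $\mathcal A_{uhhh}$: there are $N(T^\mu,T)=N(T,T^\mu)$, linear in $u$, tri-linear in $h$, free of $\tilde u$ (so of ghost number $1$) and of canonical dimension $6$, such that for $R(\cdot,\cdot)=\delta(x_1-x_2)\,N(\cdot,\cdot)(x_2)$ and $$sR(T,T)=d_QR(T,T)-i\,\partial^1_\mu R(T^\mu,T)-i\,\partial^2_\mu R(T,T^\mu)$$ one has $\delta(x_1-x_2)\,\mathcal A_{uhhh}(x_2)+sR(T,T)\simeq0$, that is, $\mathcal A_{uhhh}+d_QN(T,T)-i\,d_\mu N(T,T^\mu)\simeq0$. Here quasi-local expressions $\sum_s\partial_s\delta(x_1-x_2)\,W_s(x_2)$ are compared coefficient by coefficient. 4. There are $K^\rho$, linear in $u$, tri-linear in $h$, free of $\tilde u$ and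 of canonical dimension $6$, with $d_QN_0\simeq i\,(u_\rho\tilde{\mathcal A}^\rho+d_\rho K^\rho)$. -/

import Mathlib

open scoped BigOperators

noncomputable section

namespace QGrav

/-- The diagonal entries `(1,-1,-1,-1)` of the Minkowski metric. -/
def g (μ : Fin 4) : ℂ := if μ = 0 then 1 else -1

/-- The Minkowski metric `η_{μν}` (equal to its inverse `η^{μν}`). -/
def η (μ ν : Fin 4) : ℂ := if μ = ν then g μ else 0

/-- The jet variables, all with lower indices: `h s(μ,ν) s` is `d_{s} h_{μν}` (`h` symmetric),
`u ρ s` is `d_{s} u_ρ` and `ut σ s` is `d_{s} ũ_σ`, where the multiset `s` lists the formal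
derivatives. -/
inductive JetVar : Type
  | h (p : Sym2 (Fin 4)) (s : Multiset (Fin 4))
  | u (ρ : Fin 4) (s : Multiset (Fin 4))
  | ut (σ : Fin 4) (s : Multiset (Fin 4))

namespace JetVar

/-- The Fermi parity: `h` is even, the ghosts `u`, `ũ` are odd. -/
def odd : JetVar → Bool
  | h _ _ => false
  | u _ _ => true
  | ut _ _ => true

/-- The jet variable `d_ν ξ`. -/
def shift (ν : Fin 4) : JetVar → JetVar
  | h p s => h p (ν ::ₘ s)
  | u ρ s => u ρ (ν ::ₘ s)
  | ut σ s => ut σ (ν ::ₘ s)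

/-- The degree in `h` and its derivatives. -/
def degH : JetVar → ℕ
  | h _ _ => 1
  | u _ _ => 0
  | ut _ _ => 0

/-- The degree in `u` and its derivatives. -/
def degU : JetVar → ℕ
  | h _ _ => 0
  | u _ _ => 1
  | ut _ _ => 0

/-- The degree in `ũ` and its derivatives. -/
def degUt : JetVar → ℕ
  | h _ _ => 0
  | u _ _ => 0
  | ut _ _ => 1

/-- The canonical dimension `ω`: every field and every derivative counts one. -/
def dim : JetVar → ℕ
  | h _ s => 1 + s.card
  | u _ s => 1 + s.card
  | ut _ s => 1 + s.card

theorem odd_shift (ν : Fin 4) (x : JetVar) : (x.shift ν).odd = x.odd := by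
  cases x <;> rfl

end JetVar

/-- `-1` if the Boolean is true, else `1`. -/
def sgn (b : Bool) : ℂ := if b then -1 else 1

/-- Graded commutativity of the jet variables. -/
inductive SuperRel : FreeAlgebra ℂ JetVar → FreeAlgebra ℂ JetVar → Prop
  | comm (x y : JetVar) :
      SuperRel (FreeAlgebra.ι ℂ x * FreeAlgebra.ι ℂ y)
        (sgn (x.odd && y.odd) • (FreeAlgebra.ι ℂ y * FreeAlgebra.ι ℂ x))

/-- The free graded-commutative complex algebra on the jet variables. -/
abbrev Jet : Type := RingQuot SuperRel

/-- A jet variable as an element of the algebra. -/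
def var (x : JetVar) : Jet := RingQuot.mkAlgHom ℂ SuperRel (FreeAlgebra.ι ℂ x)

theorem var_mul_var (x y : JetVar) :
    var x * var y = sgn (x.odd && y.odd) • (var y * var x) := by
  have := RingQuot.mkAlgHom_rel ℂ (SuperRel.comm x y)
  simpa [var] using this

/-- The universal property: graded-commuting images of the jet variables extend to the algebra. -/
def jetLift {A : Type*} [Ring A] [Algebra ℂ A] (f : JetVar → A)
    (hf : ∀ x y, f x * f y = sgn (x.odd && y.odd) • (f y * f x)) : Jet →ₐ[ℂ] A :=
  RingQuot.liftAlgHom ℂ ⟨FreeAlgebra.lift ℂ f, by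
    rintro _ _ ⟨x, y⟩
    simpa using hf x y⟩

theorem jetLift_var {A : Type*} [Ring A] [Algebra ℂ A] (f : JetVar → A)
    (hf : ∀ x y, f x * f y = sgn (x.odd && y.odd) • (f y * f x)) (x : JetVar) :
    jetLift f hf (var x) = f x := by
  simp [jetLift, var]

/-- `A ↦ A` if `ε` is false; `A ↦ (-1)^{|A|} A` if `ε` is true. -/
def twist (ε : Bool) : Jet →ₐ[ℂ] Jet :=
  jetLift (fun x => sgn (ε && x.odd) • var x) (by
    intro x y
    simp only [smul_mul_assoc, mul_smul_comm, var_mul_var x y, smul_smul]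
    congr 1; ring)

/-- Graded left derivations: the linear map `D` of parity `ε` with `D(AB) = D(A) B + (-1)^{ε|A|} A D(B)`
and prescribed values `F` on the jet variables (see `gradedDeriv_var` and `gradedDeriv_mul`). It is the upper right
entry of the algebra map `A ↦ ((±A, D A), (0, A))`. -/
def gradedDeriv (ε : Bool) (F : JetVar → Jet)
    (hF : ∀ x y, F x * var y = (sgn (x.odd && y.odd) * sgn (ε && y.odd)) • (var y * F x)) :
    Jet →ₗ[ℂ] Jet :=
  (Matrix.entryLinearMap ℂ Jet (0 : Fin 2) (1 : Fin 2)).comp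
    (jetLift (A := Matrix (Fin 2) (Fin 2) Jet)
      (fun x => !![sgn (ε && x.odd) • var x, F x; 0, var x]) (by
        have hs : ∀ b, sgn b * sgn b = 1 := by intro b; cases b <;> simp [sgn]
        intro x y
        ext i j
        fin_cases i <;> fin_cases j
        · simp [var_mul_var x y, smul_smul]
          congr 1; ring
        · have h1 := hF x y
          have h2 : sgn (x.odd && y.odd) • (F y * var x) = sgn (ε && x.odd) • (var x * F y) := by
            rw [hF y x, smul_smul, Bool.and_comm y.odd x.odd, ← mul_assoc, hs, one_mul]
          simp [h1, h2, smul_smul]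
          abel
        · simp
        · simp [var_mul_var x y])).toLinearMap

theorem gradedDeriv_var (ε : Bool) (F : JetVar → Jet)
    (hF : ∀ x y, F x * var y = (sgn (x.odd && y.odd) * sgn (ε && y.odd)) • (var y * F x))
    (x : JetVar) : gradedDeriv ε F hF (var x) = F x := by
  simp [gradedDeriv, jetLift_var]

theorem jet_induction {p : Jet → Prop} (hv : ∀ x, p (var x)) (hc : ∀ c : ℂ, p (algebraMap ℂ Jet c))
    (ha : ∀ a b, p a → p b → p (a + b)) (hm : ∀ a b, p a → p b → p (a * b)) (a : Jet) : p a := by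
  obtain ⟨w, rfl⟩ := RingQuot.mkAlgHom_surjective ℂ SuperRel a
  induction w using FreeAlgebra.induction with
  | grade0 c => simpa using hc c
  | grade1 x => exact hv x
  | mul a b iha ihb => simpa using hm _ _ iha ihb
  | add a b iha ihb => simpa using ha _ _ iha ihb

theorem gradedDeriv_mul (ε : Bool) (F : JetVar → Jet)
    (hF : ∀ x y, F x * var y = (sgn (x.odd && y.odd) * sgn (ε && y.odd)) • (var y * F x))
    (a b : Jet) : gradedDeriv ε F hF (a * b) = gradedDeriv ε F hF a * b + twist ε a * gradedDeriv ε F hF b := by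
  have key : ∀ (H : Jet →ₐ[ℂ] Matrix (Fin 2) (Fin 2) Jet),
      (∀ x, H (var x) = !![sgn (ε && x.odd) • var x, F x; 0, var x]) →
      ∀ a, H a 0 0 = twist ε a ∧ H a 1 0 = 0 ∧ H a 1 1 = a := by
    intro H hH a
    induction a using jet_induction with
    | hv x => simp [hH, twist, jetLift_var]
    | hc c => simp [Matrix.algebraMap_matrix_apply, AlgHom.commutes]
    | ha a b iha ihb => simp [iha, ihb]
    | hm a b iha ihb => simp [Matrix.mul_apply, Fin.sum_univ_two, iha, ihb]
  simp only [gradedDeriv, LinearMap.comp_apply, AlgHom.toLinearMap_apply, Matrix.entryLinearMap_apply,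
    map_mul, Matrix.mul_apply, Fin.sum_univ_two]
  rw [(key _ (fun x => jetLift_var _ _ x) a).1, (key _ (fun x => jetLift_var _ _ x) b).2.2]
  abel

/-- The formal derivative `d_ν`. -/
def d (ν : Fin 4) : Jet →ₗ[ℂ] Jet :=
  gradedDeriv false (fun x => var (x.shift ν)) (by
    intro x y
    simp [var_mul_var (x.shift ν) y, JetVar.odd_shift, sgn])

/-- `d_s h_{μν}`. -/
def h (μ ν : Fin 4) (s : Multiset (Fin 4)) : Jet := var (.h s(μ, ν) s)

/-- `d_s u_ρ`. -/
def u (ρ : Fin 4) (s : Multiset (Fin 4)) : Jet := var (.u ρ s)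

/-- `d_s ũ_σ`. -/
def ut (σ : Fin 4) (s : Multiset (Fin 4)) : Jet := var (.ut σ s)

/-- `d_s h`, where `h = η^{μν} h_{μν}` is the trace. -/
def trh (s : Multiset (Fin 4)) : Jet := ∑ μ, g μ • h μ μ s

/-- The values of the gauge charge on the jet variables:
`d_Q h_{μν} = -(i/2)(d_μ u_ν + d_ν u_μ - η_{μν} d_ρ u^ρ)`, `d_Q u_ρ = 0`,
`d_Q ũ_σ = i d^λ h_{σλ}`, and the same after applying formal derivatives. -/
def dQVar : JetVar → Jet
  | .h p s => Sym2.lift ⟨fun μ ν => (-(Complex.I / 2)) •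
      (u ν (μ ::ₘ s) + u μ (ν ::ₘ s) - η μ ν • ∑ ρ, g ρ • u ρ (ρ ::ₘ s)), by
        intro μ ν
        have : η μ ν = η ν μ := by
          unfold η; by_cases e : μ = ν
          · simp [e]
          · simp [e, Ne.symm e]
        show _ • (_ - η μ ν • _) = _ • (_ - η ν μ • _)
        rw [this, add_comm (u ν _)]⟩ p
  | .u _ _ => 0
  | .ut σ s => Complex.I • ∑ lam, g lam • h σ lam (lam ::ₘ s)

/-- The gauge charge `d_Q`, an odd graded derivation. -/
def dQ : Jet →ₗ[ℂ] Jet :=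
  gradedDeriv true dQVar (by
    have hu : ∀ ρ s y, u ρ s * var y = sgn y.odd • (var y * u ρ s) := by
      intro ρ s y; simp [u, var_mul_var (.u ρ s) y, JetVar.odd]
    have hh : ∀ μ ν s y, h μ ν s * var y = var y * h μ ν s := by
      intro μ ν s y; simp [h, var_mul_var (.h _ s) y, JetVar.odd, sgn]
    intro x y
    match x with
    | .h p s =>
      induction p using Sym2.ind with
      | _ μ ν =>
        have e : sgn ((JetVar.h s(μ, ν) s).odd && y.odd) * sgn (true && y.odd) = sgn y.odd := by
          cases hy : y.odd <;> simp [JetVar.odd, sgn]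
        rw [e]
        simp only [dQVar, Sym2.lift_mk, smul_mul_assoc, mul_smul_comm, add_mul, sub_mul, mul_add,
          mul_sub, Finset.sum_mul, Finset.mul_sum, hu, smul_add, smul_sub, Finset.smul_sum,
          smul_smul]
        congr 1
        · congr 1 <;> (congr 1; ring)
        · refine Finset.sum_congr rfl fun _ _ => ?_
          congr 1; ring
    | .u ρ s => simp [dQVar]
    | .ut σ s =>
      have e : sgn ((JetVar.ut σ s).odd && y.odd) * sgn (true && y.odd) = 1 := by
        cases hy : y.odd <;> simp [JetVar.odd, sgn]
      rw [e, one_smul]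
      simp only [dQVar, smul_mul_assoc, mul_smul_comm, Finset.sum_mul, Finset.mul_sum, hh])

/-- The left derivative of parity `ε` with the constant values `c` on the variables; the values
have to vanish on the variables of the other parity. -/
def leftDeriv (ε : Bool) (c : JetVar → ℂ) (hc : ∀ x, x.odd ≠ ε → c x = 0) : Jet →ₗ[ℂ] Jet :=
  gradedDeriv ε (fun x => algebraMap ℂ Jet (c x)) (by
    intro x y
    by_cases hx : x.odd = ε
    · have e : sgn (x.odd && y.odd) * sgn (ε && y.odd) = 1 := by
        rw [hx]; cases (ε && y.odd) <;> simp [sgn]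
      rw [e, one_smul, Algebra.commutes]
    · simp [hc x hx])

/-- The Wick product `ξ · A = (-1)^{|ξ||A|} ∂A/∂ξ` with `∂` the left derivative.
For `ξ = d_s h_{μν}`, normalized by `h_{μν} · h_{ρσ} = (η_{μρ}η_{νσ} + η_{μσ}η_{νρ})/2`;
`s` has at most one element in all uses. -/
def wickH (μ ν : Fin 4) (s : Multiset (Fin 4)) : Jet →ₗ[ℂ] Jet :=
  leftDeriv false (fun x => match x with
    | .h p t => if t = s then (s.map g).prod *
        Sym2.lift ⟨fun ρ σ => (η μ ρ * η ν σ + η μ σ * η ν ρ) / 2, by intro ρ σ; ring⟩ p else 0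
    | .u _ _ => 0
    | .ut _ _ => 0) (by
      intro x hx; cases x <;> simp_all [JetVar.odd])

/-- The Wick product `u_{μ;s} · A`, normalized by `u_μ · u_ρ = η_{μρ}`. -/
def wickU (μ : Fin 4) (s : Multiset (Fin 4)) : Jet →ₗ[ℂ] Jet :=
  (leftDeriv true (fun x => match x with
    | .h _ _ => 0
    | .u ρ t => if t = s then (s.map g).prod * η μ ρ else 0
    | .ut _ _ => 0) (by
      intro x hx; cases x <;> simp_all [JetVar.odd])).comp (twist true).toLinearMap

/-- The Wick product `ũ_{μ;s} · A`, normalized by `ũ_μ · ũ_ρ = η_{μρ}`. -/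
def wickUt (μ : Fin 4) (s : Multiset (Fin 4)) : Jet →ₗ[ℂ] Jet :=
  (leftDeriv true (fun x => match x with
    | .h _ _ => 0
    | .u _ _ => 0
    | .ut ρ t => if t = s then (s.map g).prod * η μ ρ else 0) (by
      intro x hx; cases x <;> simp_all [JetVar.odd])).comp (twist true).toLinearMap

/-- The weight decomposition for weights `w` of the jet variables: the coefficient of `X^n` in
`weights w A` is the part of `A` of weight `n`. -/
def weights (w : JetVar → ℕ) : Jet →ₐ[ℂ] Polynomial Jet :=
  jetLift (fun x => Polynomial.monomial (w x) (var x)) (by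
    intro x y
    rw [Polynomial.monomial_mul_monomial, Polynomial.monomial_mul_monomial, var_mul_var x y,
      Polynomial.smul_monomial, add_comm])

/-- The part of `A` of weight `n`. -/
def weightPart (w : JetVar → ℕ) (n : ℕ) (A : Jet) : Jet := (weights w A).coeff n

/-- `A` is homogeneous of degrees `a`, `b`, `c` in `h`, `u`, `ũ` (so of ghost number `b - c`) and
of canonical dimension `n`. -/
def HasType (a b c n : ℕ) (A : Jet) : Prop :=
  weights JetVar.degH A = Polynomial.monomial a A ∧
  weights JetVar.degU A = Polynomial.monomial b A ∧
  weights JetVar.degUt A = Polynomial.monomial c A ∧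
  weights JetVar.dim A = Polynomial.monomial n A

/-- The ideal generated by the equations of motion `η^{μν} d_μ d_ν ξ = 0`, for all jet variables. -/
def eom : TwoSidedIdeal Jet :=
  TwoSidedIdeal.span (Set.range fun x : JetVar => ∑ μ, g μ • var ((x.shift μ).shift μ))

/-- Equality modulo the equations of motion. -/
def OnShellEq (A B : Jet) : Prop := A - B ∈ eom

/-- The interaction Lagrangian `T = T₁ + ⋯ + T₉`. All fields carry lower indices, and each
contracted index contributes its metric factor `g`. -/
def T : Jet :=
  -- `- h_{αβ} d^α h d^β h`
  (∑ α, ∑ β, (-(g α * g β)) • (h α β 0 * trh {α} * trh {β}))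
  -- `2 h^{αβ} d_α h_{μν} d_β h^{μν}`
  + (∑ α, ∑ β, ∑ μ, ∑ ν, (2 * (g α * g β * g μ * g ν)) • (h α β 0 * h μ ν {α} * h μ ν {β}))
  -- `4 h_{αβ} d_ν h^{βμ} d_μ h^{αν}`
  + (∑ α, ∑ β, ∑ μ, ∑ ν, (4 * (g α * g β * g μ * g ν)) • (h α β 0 * h β μ {ν} * h α ν {μ}))
  -- `2 h_{αβ} d_μ h^{αβ} d^μ h`
  + (∑ α, ∑ β, ∑ μ, (2 * (g α * g β * g μ)) • (h α β 0 * h α β {μ} * trh {μ}))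
  -- `- 4 h_{αβ} d_ν h^{αμ} d^ν h^β_μ`
  + (∑ α, ∑ β, ∑ μ, ∑ ν, (-4 * (g α * g β * g μ * g ν)) • (h α β 0 * h α μ {ν} * h β μ {ν}))
  -- `- 4 u^μ d_β ũ_ν d_μ h^{νβ}`
  + (∑ μ, ∑ ν, ∑ β, (-4 * (g μ * g ν * g β)) • (u μ 0 * ut ν {β} * h ν β {μ}))
  -- `4 d_ν u^β d_μ ũ_β h^{μν}`
  + (∑ μ, ∑ ν, ∑ β, (4 * (g μ * g ν * g β)) • (u β {ν} * ut β {μ} * h μ ν 0))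
  -- `- 4 d^ν u_ν d_α ũ_β h^{αβ}`
  + (∑ ν, ∑ α, ∑ β, (-4 * (g ν * g α * g β)) • (u ν {ν} * ut β {α} * h α β 0))
  -- `4 d_ν u^μ d_μ ũ_β h^{νβ}`
  + (∑ μ, ∑ ν, ∑ β, (4 * (g μ * g ν * g β)) • (u μ {ν} * ut β {μ} * h ν β 0))

/-- The Wick submonomial `B_{μν} = ũ_{μ,ν} · T`. -/
def B (μ ν : Fin 4) : Jet := wickUt μ {ν} T

/-- `C_{μν} = h_{μν} · T`. -/
def C (μ ν : Fin 4) : Jet := wickH μ ν 0 T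

/-- `D_μ = u_μ · T`. -/
def D (μ : Fin 4) : Jet := wickU μ 0 T

/-- `E_{μν,λ} = h_{μν,λ} · T`. -/
def E (μ ν lam : Fin 4) : Jet := wickH μ ν {lam} T

/-- `F_{μ,ν} = u_{μ,ν} · T`. -/
def F (μ ν : Fin 4) : Jet := wickU μ {ν} T

/-- `B_{1μ} = 2 u^σ d_σ u_μ`. -/
def B1 (μ : Fin 4) : Jet := ∑ σ, (2 * g σ) • (u σ 0 * u μ {σ})

/-- The second order anomaly without its total divergence,
`B^{μν} (C_{μν} - d^λ E_{μν,λ}) + 2 B₁^μ (D_μ - d^λ F_{μ,λ})`. -/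
def anomaly : Jet :=
  (∑ μ, ∑ ν, (g μ * g ν) • (B μ ν * (C μ ν - ∑ lam, g lam • d lam (E μ ν lam))))
  + ∑ μ, (2 * g μ) • (B1 μ * (D μ - ∑ lam, g lam • d lam (F μ lam)))

/-- The contribution `A_{uhhh}` to the anomaly: its part tri-linear in `h`. -/
def anomalyUHHH : Jet := weightPart JetVar.degH 3 anomaly

/-- `𝒟 = 2 (h^{ρσ}_{,σ} h_{,ρ} + h^{ρσ} h_{,ρσ} - h^{ρσ,λ} h_{ρσ,λ})`. -/
def calD : Jet :=
  (2 : ℂ) • ((∑ ρ, ∑ σ, (g ρ * g σ) • (h ρ σ {σ} * trh {ρ}))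
    + (∑ ρ, ∑ σ, (g ρ * g σ) • (h ρ σ 0 * trh {ρ, σ}))
    - ∑ ρ, ∑ σ, ∑ lam, (g ρ * g σ * g lam) • (h ρ σ {lam} * h ρ σ {lam}))

/-- `𝒟_{μν} = - h_{,μ} h_{,ν} + 2 h^{ρσ}_{,μ} h_{ρσ,ν}
+ 4 (h_{μρ,σ} h_ν^{σ,ρ} + h_{μρ,σ} h_ν^{ρ,σ}) - 4 (h^{ρσ}_{,ρ} h_{μν,σ} + h^{ρσ} h_{μν,ρσ})
- 4 (h_{μρ,σ} h^{ρσ}_{,ν} + h_{νρ,σ} h^{ρσ}_{,μ} + h_{μρ} h^{ρσ}_{,νσ} + h_{νρ} h^{ρσ}_{,μσ})`. -/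
def calDD (μ ν : Fin 4) : Jet :=
  -(trh {μ} * trh {ν})
  + (2 : ℂ) • (∑ ρ, ∑ σ, (g ρ * g σ) • (h ρ σ {μ} * h ρ σ {ν}))
  + (4 : ℂ) • (∑ ρ, ∑ σ, (g ρ * g σ) • (h μ ρ {σ} * h ν σ {ρ} + h μ ρ {σ} * h ν ρ {σ}))
  - (4 : ℂ) • (∑ ρ, ∑ σ, (g ρ * g σ) • (h ρ σ {ρ} * h μ ν {σ} + h ρ σ 0 * h μ ν {ρ, σ}))
  - (4 : ℂ) • (∑ ρ, ∑ σ, (g ρ * g σ) • (h μ ρ {σ} * h ρ σ {ν} + h ν ρ {σ} * h ρ σ {μ}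
      + h μ ρ 0 * h ρ σ {ν, σ} + h ν ρ 0 * h ρ σ {μ, σ}))

/-- `𝒜_ρ = 4 h_{,ρ} 𝒟 + 4 h_{μν,ρ} 𝒟^{μν}`. -/
def calA1 (ρ : Fin 4) : Jet :=
  (4 : ℂ) • (trh {ρ} * calD) + (4 : ℂ) • ∑ μ, ∑ ν, (g μ * g ν) • (h μ ν {ρ} * calDD μ ν)

/-- `𝒜 = 4 h 𝒟 + 4 h_{μν} 𝒟^{μν}`. -/
def calA0 : Jet :=
  (4 : ℂ) • (trh 0 * calD) + (4 : ℂ) • ∑ μ, ∑ ν, (g μ * g ν) • (h μ ν 0 * calDD μ ν)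

/-- `𝒜_{μν} = - 8 h_{μν} 𝒟 - 8 h_ν^λ 𝒟_{μλ}`. -/
def calA2 (μ ν : Fin 4) : Jet :=
  (-8 : ℂ) • (h μ ν 0 * calD) + (-8 : ℂ) • ∑ lam, g lam • (h ν lam 0 * calDD μ lam)

/-- `𝒜̃_ρ = 𝒜_ρ - d_ρ 𝒜 - d^σ 𝒜_{ρσ}`. -/
def calAtilde (ρ : Fin 4) : Jet :=
  calA1 ρ - d ρ calA0 - ∑ σ, g σ • d σ (calA2 ρ σ)

/-- The combination `N₀` of seven terms `h h dh dh`. -/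
def N0 : Jet :=
  -- `- 16 h^{μν} h^{ρσ} d_ρ h_{μν} d_σ h`
  (∑ μ, ∑ ν, ∑ ρ, ∑ σ, (-16 * (g μ * g ν * g ρ * g σ)) •
    (h μ ν 0 * h ρ σ 0 * h μ ν {ρ} * trh {σ}))
  -- `8 h^{μν} h^{ρσ} d_λ h_{μν} d^λ h_{ρσ}`
  + (∑ μ, ∑ ν, ∑ ρ, ∑ σ, ∑ lam, (8 * (g μ * g ν * g ρ * g σ * g lam)) •
    (h μ ν 0 * h ρ σ 0 * h μ ν {lam} * h ρ σ {lam}))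
  -- `32 h^{μν} h_{νρ} d^α h^{ρβ} d_β h_{μα}`
  + (∑ μ, ∑ ν, ∑ ρ, ∑ α, ∑ β, (32 * (g μ * g ν * g ρ * g α * g β)) •
    (h μ ν 0 * h ν ρ 0 * h ρ β {α} * h μ α {β}))
  -- `32 h^{μν} h^{ρσ} d_μ h_{ρα} d_ν h_σ^α`
  + (∑ μ, ∑ ν, ∑ ρ, ∑ σ, ∑ α, (32 * (g μ * g ν * g ρ * g σ * g α)) •
    (h μ ν 0 * h ρ σ 0 * h ρ α {μ} * h σ α {ν}))
  -- `- 32 h^{μν} h_{νρ} d^α h_{μβ} d_α h^{ρβ}`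
  + (∑ μ, ∑ ν, ∑ ρ, ∑ α, ∑ β, (-32 * (g μ * g ν * g ρ * g α * g β)) •
    (h μ ν 0 * h ν ρ 0 * h μ β {α} * h ρ β {α}))
  -- `- 16 h^{μν} h^{ρσ} d_λ h_{μρ} d^λ h_{νσ}`
  + (∑ μ, ∑ ν, ∑ ρ, ∑ σ, ∑ lam, (-16 * (g μ * g ν * g ρ * g σ * g lam)) •
    (h μ ν 0 * h ρ σ 0 * h μ ρ {lam} * h ν σ {lam}))
  -- `16 h^{μν} h_ν^ρ d^λ h_{μρ} d_λ h`
  + (∑ μ, ∑ ν, ∑ ρ, ∑ lam, (16 * (g μ * g ν * g ρ * g lam)) •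
    (h μ ν 0 * h ν ρ 0 * h μ ρ {lam} * trh {lam}))

/-- The finite renormalization polynomial `N(T,T) = i N₀`. -/
def NTT : Jet := Complex.I • N0

/-- Quasi-local expressions `∑_s ∂_s δ(x₁ - x₂) W_s(x₂)`, given by the coefficients `W_s`. -/
abbrev QuasiLocal : Type := Multiset (Fin 4) →₀ Jet

/-- `δ(x₁ - x₂) W(x₂)`. -/
def delta (W : Jet) : QuasiLocal := Finsupp.single 0 W

/-- `∂/∂x₁^μ` on quasi-local expressions. -/
def partial1 (μ : Fin 4) (R : QuasiLocal) : QuasiLocal :=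
  R.mapDomain (fun s => μ ::ₘ s)

/-- `∂/∂x₂^μ` on quasi-local expressions. -/
def partial2 (μ : Fin 4) (R : QuasiLocal) : QuasiLocal :=
  R.mapRange (d μ) (map_zero _) - R.mapDomain (fun s => μ ::ₘ s)

/-- `sR(T(x₁),T(x₂)) = d_Q R(T,T) - i ∂¹_μ R(T^μ,T) - i ∂²_μ R(T,T^μ)`; the arguments are
`R(T,T)`, `R(T^μ,T)` and `R(T,T^μ)`. -/
def sR (R : QuasiLocal) (R1 R2 : Fin 4 → QuasiLocal) : QuasiLocal :=
  R.mapRange dQ (map_zero _) - Complex.I • (∑ μ, partial1 μ (R1 μ))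
    - Complex.I • (∑ μ, partial2 μ (R2 μ))

/-- Vanishing of a quasi-local expression on shell. -/
def VanishesOnShell (R : QuasiLocal) : Prop := ∀ s, OnShellEq (R s) 0

end QGrav

end

open QGrav

noncomputable section

namespace QGrav

/-! The claims are transported to polynomial identities between Minkowski products. An expression
linear in the ghost and trilinear in `h` is encoded by a symbol: each factor gets a polarization and
a momentum, so that a field becomes a monomial. `quantU` sends symbols back to the jet algebra and
discards every momentum degree but one. Under it a formal derivative is multiplication by the total
momentum (`d_quantU`), the square of any single momentum lands in the ideal of the equations of
motion (`quantU_box₀` to `quantU_box₃`), and permuting the three `h` changes nothing because they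
commute (`quantU_swap₁₂`, `quantU_swap₂₃`). Modulo equations of motion and divergences, one may
therefore compute with massless momenta adding up to zero, and only the symmetrized symbol matters.

The anomaly is treated first. Counting powers of `h` leaves only the product of `ũ_{μ,ν} · T` with
the Euler derivative of the purely gravitational cubic part of `T` (`anomalyUHHH_eq`). The four
ghost terms of `T` then give a contraction of that Euler derivative with `u h`
(`anomalyUHHH_eq_ghostContraction`). On shell the Euler derivative equals `𝒟_{μν} + η_{μν} 𝒟`
(`eulerH_Thhh_onShell`), and the tensors `𝒜_ρ`, `𝒜`, `𝒜_{μν}` are exactly its contractions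
(`anomalyForm_eq`). This is the first claim.

For the renormalization, the symbols of `d_Q N₀` (`dQ_N0`) and of the anomaly
(`ghostContraction_calD`) are computed. Up to the factor `-i/2`, the difference of `d_Q N₀` and `i`
times the anomaly has the symbol `defect`. Its sum over the six permutations of the fields `h`
vanishes for massless conserved momenta (`sum_defect`), so the difference is on shell the divergence
of a current `K`. This `K` serves as `N(T^μ,T) = N(T,T^μ)`. The last claim follows by moving the
derivatives off the ghosts, which costs another divergence (`anomalyForm_eq_add_divergence`). -/

/-! ### Metric signs and the symmetry of `h` -/

theorem g_mul_self (μ : Fin 4) : g μ * g μ = 1 := by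
  unfold g; split <;> norm_num

theorem η_comm (μ ν : Fin 4) : η μ ν = η ν μ := by
  unfold η
  by_cases e : μ = ν
  · simp [e]
  · simp [e, Ne.symm e]

theorem h_symm (μ ν : Fin 4) (s : Multiset (Fin 4)) : h μ ν s = h ν μ s := by
  rw [h, h, Sym2.eq_swap]

theorem jet_neg_smul (c : ℂ) (a : Jet) : (-c) • a = -(c • a) := neg_smul c a

theorem jet_neg_mul (a b : Jet) : -a * b = -(a * b) := neg_mul a b

theorem jet_mul_neg (a b : Jet) : a * -b = -(a * b) := mul_neg a b

/-! ### The derivations on products and on variables -/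

theorem twist_false (a : Jet) : twist false a = a := by
  induction a using jet_induction with
  | hv x => simp [twist, jetLift_var, sgn]
  | hc c => exact AlgHom.commutes _ c
  | ha a b iha ihb => rw [map_add, iha, ihb]
  | hm a b iha ihb => rw [map_mul, iha, ihb]

theorem twist_h (ε : Bool) (μ ν : Fin 4) (s : Multiset (Fin 4)) :
    twist ε (h μ ν s) = h μ ν s := by
  cases ε <;> simp [h, twist, jetLift_var, JetVar.odd, sgn]

theorem twist_u (ρ : Fin 4) (s : Multiset (Fin 4)) : twist true (u ρ s) = -u ρ s := by
  simp [u, twist, jetLift_var, JetVar.odd, sgn, jet_neg_smul]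

theorem twist_ut (σ : Fin 4) (s : Multiset (Fin 4)) : twist true (ut σ s) = -ut σ s := by
  simp [ut, twist, jetLift_var, JetVar.odd, sgn, jet_neg_smul]

theorem d_mul (ν : Fin 4) (a b : Jet) : d ν (a * b) = d ν a * b + a * d ν b := by
  rw [d, gradedDeriv_mul, twist_false]

theorem d_var (ν : Fin 4) (x : JetVar) : d ν (var x) = var (x.shift ν) := gradedDeriv_var _ _ _ x

theorem d_h (ν α β : Fin 4) (s : Multiset (Fin 4)) : d ν (h α β s) = h α β (ν ::ₘ s) := d_var ..

theorem d_u (ν ρ : Fin 4) (s : Multiset (Fin 4)) : d ν (u ρ s) = u ρ (ν ::ₘ s) := d_var ..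

theorem d_ut (ν ρ : Fin 4) (s : Multiset (Fin 4)) : d ν (ut ρ s) = ut ρ (ν ::ₘ s) := d_var ..

/-- Even variables are central: the exchange sign is trivial against every generator, and centrality
passes to sums and products. -/
theorem h_mul_comm (μ ν : Fin 4) (s : Multiset (Fin 4)) (A : Jet) :
    h μ ν s * A = A * h μ ν s := by
  induction A using jet_induction with
  | hv y => simp [h, var_mul_var (.h _ s) y, JetVar.odd, sgn]
  | hc c => exact (Algebra.commutes c _).symm
  | ha a b iha ihb => rw [mul_add, add_mul, iha, ihb]
  | hm a b iha ihb => rw [← mul_assoc, iha, mul_assoc, ihb, mul_assoc]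

theorem dQ_mul (a b : Jet) : dQ (a * b) = dQ a * b + twist true a * dQ b := gradedDeriv_mul ..

theorem dQ_h (μ ν : Fin 4) (s : Multiset (Fin 4)) :
    dQ (h μ ν s) = (-(Complex.I / 2)) •
      (u ν (μ ::ₘ s) + u μ (ν ::ₘ s) - η μ ν • ∑ ρ, g ρ • u ρ (ρ ::ₘ s)) := by
  rw [h, dQ, gradedDeriv_var]; rfl

/-- The value of `wickH μ ν s` on `h α β s`, up to the metric factors of `s`. -/
def symη (μ ν α β : Fin 4) : ℂ := (η μ α * η ν β + η μ β * η ν α) / 2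

theorem wickH_mul (μ ν : Fin 4) (s : Multiset (Fin 4)) (a b : Jet) :
    wickH μ ν s (a * b) = wickH μ ν s a * b + a * wickH μ ν s b := by
  rw [wickH, leftDeriv, gradedDeriv_mul, twist_false]

theorem wickH_h (μ ν : Fin 4) (s : Multiset (Fin 4)) (α β : Fin 4) (t : Multiset (Fin 4)) :
    wickH μ ν s (h α β t) = algebraMap ℂ Jet (if t = s then (s.map g).prod * symη μ ν α β else 0) := by
  rw [wickH, leftDeriv, h, gradedDeriv_var]; rfl

theorem wickH_u (μ ν : Fin 4) (s : Multiset (Fin 4)) (ρ : Fin 4) (t : Multiset (Fin 4)) :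
    wickH μ ν s (u ρ t) = 0 := by
  rw [wickH, leftDeriv, u, gradedDeriv_var]; simp

theorem wickH_ut (μ ν : Fin 4) (s : Multiset (Fin 4)) (ρ : Fin 4) (t : Multiset (Fin 4)) :
    wickH μ ν s (ut ρ t) = 0 := by
  rw [wickH, leftDeriv, ut, gradedDeriv_var]; simp

theorem wickH_symm (μ ν : Fin 4) (s : Multiset (Fin 4)) : wickH μ ν s = wickH ν μ s := by
  unfold wickH
  congr 1
  funext x
  match x with
  | .h p t =>
    induction p using Sym2.ind with
    | _ α β =>
      simp only [Sym2.lift_mk]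
      congr 2
      ring
  | .u _ _ => rfl
  | .ut _ _ => rfl

theorem wickUt_hhh (μ : Fin 4) (s : Multiset (Fin 4)) (a b c e f i : Fin 4)
    (r t w : Multiset (Fin 4)) : wickUt μ s (h a b r * h c e t * h f i w) = 0 := by
  simp only [wickUt, LinearMap.comp_apply, AlgHom.toLinearMap_apply, map_mul, twist_h, leftDeriv,
    gradedDeriv_mul]
  simp only [h, gradedDeriv_var]
  simp

theorem wickU_hhh (μ : Fin 4) (s : Multiset (Fin 4)) (a b c e f i : Fin 4)
    (r t w : Multiset (Fin 4)) : wickU μ s (h a b r * h c e t * h f i w) = 0 := by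
  simp only [wickU, LinearMap.comp_apply, AlgHom.toLinearMap_apply, map_mul, twist_h, leftDeriv,
    gradedDeriv_mul]
  simp only [h, gradedDeriv_var]
  simp

/-- The parity twist is trivial on the even product `u ũ h`; the minus sign comes from moving the
odd derivative past `u`. For the derivative in `u` nothing is passed, hence no sign there. -/
theorem wickUt_uuth (μ : Fin 4) (s : Multiset (Fin 4)) (a b c e : Fin 4)
    (r t w : Multiset (Fin 4)) : wickUt μ s (u a r * ut b t * h c e w) =
      (-(if t = s then (s.map g).prod * η μ b else 0)) • (u a r * h c e w) := by
  simp only [wickUt, LinearMap.comp_apply, AlgHom.toLinearMap_apply, map_mul, twist_h, twist_u,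
    twist_ut, leftDeriv, gradedDeriv_mul, map_neg]
  simp only [h, u, ut, gradedDeriv_var]
  simp only [map_zero, zero_mul, mul_zero, add_zero, zero_add, jet_neg_mul, jet_mul_neg, neg_neg,
    Algebra.smul_def, map_neg]
  rw [← Algebra.commutes, mul_assoc]

theorem wickU_uuth (μ : Fin 4) (s : Multiset (Fin 4)) (a b c e : Fin 4)
    (r t w : Multiset (Fin 4)) : wickU μ s (u a r * ut b t * h c e w) =
      (if r = s then (s.map g).prod * η μ a else 0) • (ut b t * h c e w) := by
  simp only [wickU, LinearMap.comp_apply, AlgHom.toLinearMap_apply, map_mul, twist_h, twist_u,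
    twist_ut, leftDeriv, gradedDeriv_mul, map_neg]
  simp only [h, u, ut, gradedDeriv_var]
  simp only [map_zero, mul_zero, add_zero, jet_neg_mul, jet_mul_neg, neg_neg, Algebra.smul_def,
    neg_zero, mul_assoc]

theorem wickH_uuth (μ ν : Fin 4) (s : Multiset (Fin 4)) (a b c e : Fin 4)
    (r t w : Multiset (Fin 4)) : wickH μ ν s (u a r * ut b t * h c e w) =
      (if w = s then (s.map g).prod * symη μ ν c e else 0) • (u a r * ut b t) := by
  rw [wickH_mul, wickH_mul, wickH_u, wickH_ut, wickH_h, Algebra.smul_def, ← Algebra.commutes]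
  simp

/-! ### Homogeneous elements -/

/-- The elements of weight `n`. -/
def homog (w : JetVar → ℕ) (n : ℕ) : Submodule ℂ Jet where
  carrier := {A | weights w A = Polynomial.monomial n A}
  add_mem' := by
    intro a b ha hb
    simp only [Set.mem_ofPred_eq] at *
    rw [map_add, map_add, ha, hb]
  zero_mem' := by simp
  smul_mem' := by
    intro c a ha
    simp only [Set.mem_ofPred_eq] at *
    rw [map_smul, ha, Polynomial.smul_monomial]

theorem mem_homog {w : JetVar → ℕ} {n : ℕ} {A : Jet} :
    A ∈ homog w n ↔ weights w A = Polynomial.monomial n A := Iff.rfl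

theorem var_mem_homog (w : JetVar → ℕ) (x : JetVar) : var x ∈ homog w (w x) := by
  rw [mem_homog, weights, jetLift_var]

theorem mul_mem_homog {w : JetVar → ℕ} {m n : ℕ} {A B : Jet} (hA : A ∈ homog w m)
    (hB : B ∈ homog w n) : A * B ∈ homog w (m + n) := by
  rw [mem_homog] at *
  rw [map_mul, hA, hB, Polynomial.monomial_mul_monomial]

theorem weightPart_of_mem {w : JetVar → ℕ} {n : ℕ} {A : Jet} (hA : A ∈ homog w n) :
    weightPart w n A = A := by
  rw [weightPart, mem_homog.1 hA, Polynomial.coeff_monomial, if_pos rfl]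

theorem weightPart_of_mem_ne {w : JetVar → ℕ} {m n : ℕ} {A : Jet} (hA : A ∈ homog w m)
    (hmn : m ≠ n) : weightPart w n A = 0 := by
  rw [weightPart, mem_homog.1 hA, Polynomial.coeff_monomial, if_neg hmn]

theorem weightPart_add (w : JetVar → ℕ) (n : ℕ) (A B : Jet) :
    weightPart w n (A + B) = weightPart w n A + weightPart w n B := by
  simp [weightPart]

theorem hasType_iff {a b c n : ℕ} {A : Jet} : HasType a b c n A ↔
    A ∈ homog JetVar.degH a ∧ A ∈ homog JetVar.degU b ∧ A ∈ homog JetVar.degUt c ∧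
      A ∈ homog JetVar.dim n := Iff.rfl

/-- The elements of a given type form a submodule. -/
def typed (a b c n : ℕ) : Submodule ℂ Jet :=
  homog JetVar.degH a ⊓ homog JetVar.degU b ⊓ homog JetVar.degUt c ⊓ homog JetVar.dim n

theorem mem_typed {a b c n : ℕ} {A : Jet} : A ∈ typed a b c n ↔ HasType a b c n A := by
  simp only [typed, Submodule.mem_inf, hasType_iff, and_assoc]

theorem mul_mem_typed {a b c n a' b' c' n' : ℕ} {A B : Jet} (hA : A ∈ typed a b c n)
    (hB : B ∈ typed a' b' c' n') : A * B ∈ typed (a + a') (b + b') (c + c') (n + n') := by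
  rw [mem_typed, hasType_iff] at *
  exact ⟨mul_mem_homog hA.1 hB.1, mul_mem_homog hA.2.1 hB.2.1, mul_mem_homog hA.2.2.1 hB.2.2.1,
    mul_mem_homog hA.2.2.2 hB.2.2.2⟩

theorem var_mem_typed (x : JetVar) : var x ∈ typed x.degH x.degU x.degUt x.dim := by
  rw [mem_typed]
  exact ⟨var_mem_homog _ x, var_mem_homog _ x, var_mem_homog _ x, var_mem_homog _ x⟩

theorem h_mem_typed (μ ν : Fin 4) (s : Multiset (Fin 4)) :
    h μ ν s ∈ typed 1 0 0 (1 + s.card) :=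
  var_mem_typed (.h s(μ, ν) s)

theorem u_mem_typed (ρ : Fin 4) (s : Multiset (Fin 4)) :
    u ρ s ∈ typed 0 1 0 (1 + s.card) :=
  var_mem_typed (.u ρ s)

theorem trh_mem_typed (s : Multiset (Fin 4)) : trh s ∈ typed 1 0 0 (1 + s.card) :=
  Submodule.sum_mem _ fun _ _ => Submodule.smul_mem _ _ (h_mem_typed _ _ _)

theorem N0_mem_typed : N0 ∈ typed 4 0 0 6 := by
  have key : ∀ (a b c e : Jet), a ∈ typed 1 0 0 1 → b ∈ typed 1 0 0 1 → c ∈ typed 1 0 0 2 →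
      e ∈ typed 1 0 0 2 → ∀ r : ℂ, r • (a * b * c * e) ∈ typed 4 0 0 6 := by
    intro a b c e ha hb hc he r
    have := mul_mem_typed (mul_mem_typed (mul_mem_typed ha hb) hc) he
    norm_num at this
    exact Submodule.smul_mem _ _ this
  have h0 : ∀ μ ν, h μ ν 0 ∈ typed 1 0 0 1 := fun μ ν => h_mem_typed μ ν 0
  have h1 : ∀ μ ν α, h μ ν {α} ∈ typed 1 0 0 2 := fun μ ν α => h_mem_typed μ ν {α}
  have t1 : ∀ α, trh {α} ∈ typed 1 0 0 2 := fun α => trh_mem_typed {α}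
  unfold N0
  refine Submodule.add_mem _ (Submodule.add_mem _ (Submodule.add_mem _ (Submodule.add_mem _
    (Submodule.add_mem _ (Submodule.add_mem _ ?_ ?_) ?_) ?_) ?_) ?_) ?_
  all_goals
    repeat' refine Submodule.sum_mem _ fun _ _ => ?_
    first
    | exact key _ _ _ _ (h0 _ _) (h0 _ _) (h1 _ _ _) (h1 _ _ _) _
    | exact key _ _ _ _ (h0 _ _) (h0 _ _) (h1 _ _ _) (t1 _) _

/-! ### Symbols of multilinear expressions -/

/-- A monomial in the polarization and the momentum of one field. -/
abbrev Slot : Type := Multiset (Fin 4) × Multiset (Fin 4)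

/-- The field `d_s h_{μν}` with symbol `e_μ e_ν k^s`; zero unless the degree in `e` is two. -/
def slotH (a : Slot) : Jet :=
  ∑ p : Sym2 (Fin 4), if p.toMultiset = a.1 then var (.h p a.2) else 0

/-- The field `d_s u_ρ` with symbol `e_ρ k^s`; zero unless the degree in `e` is one. -/
def slotU (a : Slot) : Jet := ∑ ρ, if ({ρ} : Multiset (Fin 4)) = a.1 then u ρ a.2 else 0

theorem toMultiset_mk (μ ν : Fin 4) : (s(μ, ν)).toMultiset = ({μ, ν} : Multiset (Fin 4)) := rfl

/-- Ensures that at most one summand of `slotH` survives, so a quadratic polarization picks out one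
component of the symmetric tensor. -/
theorem toMultiset_inj {p q : Sym2 (Fin 4)} : p.toMultiset = q.toMultiset ↔ p = q := by
  revert p q; decide

theorem slotH_pair (μ ν : Fin 4) (s : Multiset (Fin 4)) : slotH ({μ, ν}, s) = h μ ν s := by
  simp only [slotH, ← toMultiset_mk, toMultiset_inj]
  rw [Finset.sum_ite_eq' Finset.univ s(μ, ν), if_pos (Finset.mem_univ _), h]

theorem slotU_single (ρ : Fin 4) (s : Multiset (Fin 4)) : slotU ({ρ}, s) = u ρ s := by
  simp only [slotU, Multiset.singleton_inj]
  rw [Finset.sum_ite_eq' Finset.univ ρ, if_pos (Finset.mem_univ _)]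

theorem slotH_mul_comm (a : Slot) (A : Jet) : slotH a * A = A * slotH a := by
  rw [slotH, Finset.sum_mul, Finset.mul_sum]
  refine Finset.sum_congr rfl fun p _ => ?_
  split_ifs
  · induction p using Sym2.ind with
    | _ μ ν => exact h_mul_comm μ ν a.2 A
  · rw [zero_mul, mul_zero]

/-- A derivative is multiplication by the momentum; the polarization is untouched. -/
theorem d_slotH (μ : Fin 4) (a : Slot) : d μ (slotH a) = slotH ((0, {μ}) + a) := by
  simp only [slotH, map_sum]
  refine Finset.sum_congr rfl fun p _ => ?_
  simp only [Prod.fst_add, Prod.snd_add, zero_add, Multiset.singleton_add]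
  split_ifs
  · exact d_var _ _
  · exact map_zero _

theorem d_slotU (μ : Fin 4) (a : Slot) : d μ (slotU a) = slotU ((0, {μ}) + a) := by
  simp only [slotU, map_sum]
  refine Finset.sum_congr rfl fun p _ => ?_
  simp only [Prod.fst_add, Prod.snd_add, zero_add, Multiset.singleton_add]
  split_ifs
  · exact d_var _ _
  · exact map_zero _

theorem slotH_mem_typed (a : Slot) : slotH a ∈ typed 1 0 0 (1 + a.2.card) := by
  refine Submodule.sum_mem _ fun p _ => ?_
  split_ifs
  · exact var_mem_typed (.h p a.2)
  · exact Submodule.zero_mem _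

theorem slotU_mem_typed (a : Slot) : slotU a ∈ typed 0 1 0 (1 + a.2.card) := by
  refine Submodule.sum_mem _ fun p _ => ?_
  split_ifs
  · exact u_mem_typed p a.2
  · exact Submodule.zero_mem _

/-! ### The ideal of the equations of motion -/

theorem smul_mem_eom (c : ℂ) {a : Jet} (ha : a ∈ eom) : c • a ∈ eom := by
  rw [Algebra.smul_def]
  exact eom.mul_mem_left _ _ ha

/-- The ideal of the equations of motion as a subspace. -/
def eomSubmodule : Submodule ℂ Jet where
  carrier := {a | a ∈ eom}
  add_mem' := eom.add_mem
  zero_mem' := eom.zero_mem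
  smul_mem' := fun c _ => smul_mem_eom c

theorem mem_eomSubmodule {a : Jet} : a ∈ eomSubmodule ↔ a ∈ eom := Iff.rfl

theorem box_var_mem_eom (x : JetVar) : ∑ μ, g μ • var ((x.shift μ).shift μ) ∈ eom :=
  TwoSidedIdeal.subset_span ⟨x, rfl⟩

/-- After exchanging the sums, each component contributes either zero or a generator of the ideal:
this is masslessness of one slot. -/
theorem box_slotH_mem_eom (a : Slot) : ∑ μ, g μ • slotH ((0, {μ} + {μ}) + a) ∈ eom := by
  simp only [slotH, Finset.smul_sum]
  rw [Finset.sum_comm, ← mem_eomSubmodule]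
  refine Submodule.sum_mem _ fun p _ => ?_
  simp only [Prod.fst_add, Prod.snd_add, zero_add, Multiset.singleton_add]
  by_cases hp : p.toMultiset = a.1
  · simpa [hp] using! box_var_mem_eom (.h p a.2)
  · simp [hp]

theorem box_slotU_mem_eom (a : Slot) : ∑ μ, g μ • slotU ((0, {μ} + {μ}) + a) ∈ eom := by
  simp only [slotU, Finset.smul_sum]
  rw [Finset.sum_comm, ← mem_eomSubmodule]
  refine Submodule.sum_mem _ fun p _ => ?_
  simp only [Prod.fst_add, Prod.snd_add, zero_add, Multiset.singleton_add]
  by_cases hp : {p} = a.1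
  · simpa [hp] using! box_var_mem_eom (.u p a.2)
  · simp [hp]

/-! ### Linear maps on monoid algebras -/

/-- The linear map on a monoid algebra with prescribed values on the monomials. -/
def umbral {M : Type} (f : M → Jet) : AddMonoidAlgebra ℂ M →ₗ[ℂ] Jet :=
  (Finsupp.linearCombination ℂ f).comp (AddMonoidAlgebra.coeffLinearEquiv ℂ).toLinearMap

/-- A monomial. -/
def mon {M : Type} (m : M) : AddMonoidAlgebra ℂ M := AddMonoidAlgebra.single m 1

theorem umbral_mon {M : Type} (f : M → Jet) (m : M) : umbral f (mon m) = f m := by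
  simp [umbral, mon]

theorem mon_mul_mon {M : Type} [AddCommMonoid M] (m n : M) : mon m * mon n = mon (m + n) := by
  simp [mon]

theorem mon_induction {M : Type} {P : AddMonoidAlgebra ℂ M → Prop} (hm : ∀ m, P (mon m))
    (h0 : P 0) (ha : ∀ x y, P x → P y → P (x + y)) (hs : ∀ (c : ℂ) x, P x → P (c • x))
    (x : AddMonoidAlgebra ℂ M) : P x := by
  refine AddMonoidAlgebra.induction_linear x h0 (fun x y => ha x y) fun m c => ?_
  have : (AddMonoidAlgebra.single m c : AddMonoidAlgebra ℂ M) = c • mon m := by simp [mon]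
  rw [this]
  exact hs c _ (hm m)

theorem linearMap_eq_of_mon {M : Type} {f f' : AddMonoidAlgebra ℂ M →ₗ[ℂ] Jet}
    (H : ∀ m, f (mon m) = f' (mon m)) (x : AddMonoidAlgebra ℂ M) : f x = f' x := by
  induction x using mon_induction with
  | hm m => exact H m
  | h0 => rw [map_zero, map_zero]
  | ha x y hx hy => rw [map_add, map_add, hx, hy]
  | hs c x hx => rw [map_smul, map_smul, hx]

theorem linearMap_mem_of_mon {M : Type} {f : AddMonoidAlgebra ℂ M →ₗ[ℂ] Jet} {S : Submodule ℂ Jet}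
    (H : ∀ m, f (mon m) ∈ S) (x : AddMonoidAlgebra ℂ M) : f x ∈ S := by
  induction x using mon_induction with
  | hm m => exact H m
  | h0 => rw [map_zero]; exact S.zero_mem
  | ha x y hx hy => rw [map_add]; exact S.add_mem hx hy
  | hs c x hx => rw [map_smul]; exact S.smul_mem c hx

/-- The Minkowski product. -/
def dot {R : Type} [CommRing R] [Algebra ℂ R] (a b : Fin 4 → R) : R := ∑ μ, g μ • (a μ * b μ)

/-! ### Two fields `h` -/

/-- Symbols of bilinear expressions in `h`. -/
abbrev Symb2 : Type := AddMonoidAlgebra ℂ (Slot × Slot)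

/-- The bilinear expression with a given symbol of degree `n` in the momenta. -/
def quantHH (n : ℕ) : Symb2 →ₗ[ℂ] Jet := umbral fun m =>
  if m.1.2.card + m.2.2.card = n then slotH m.1 * slotH m.2 else 0

namespace Symb2

/-- The polarization of the first `h`. -/
def pol₁ (μ : Fin 4) : Symb2 := mon (({μ}, 0), 0)

/-- The momentum of the first `h`. -/
def mom₁ (μ : Fin 4) : Symb2 := mon ((0, {μ}), 0)

/-- The polarization of the second `h`. -/
def pol₂ (μ : Fin 4) : Symb2 := mon (0, ({μ}, 0))

/-- The momentum of the second `h`. -/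
def mom₂ (μ : Fin 4) : Symb2 := mon (0, (0, {μ}))

/-- The exchange of the two fields. -/
def swap : Symb2 →ₐ[ℂ] Symb2 :=
  AddMonoidAlgebra.mapDomainAlgHom ℂ ℂ (AddEquiv.prodComm (M := Slot) (N := Slot)).toAddMonoidHom

theorem swap_mon (a b : Slot) : swap (mon (a, b)) = mon (b, a) := by
  simp [swap, mon]

end Symb2

theorem quantHH_mon (n : ℕ) (a b : Slot) : quantHH n (mon (a, b)) =
    if a.2.card + b.2.card = n then slotH a * slotH b else 0 := umbral_mon _ _

/-- Bose symmetry: the two fields commute, so a symbol counts only up to symmetrization. -/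
theorem quantHH_swap (n : ℕ) (x : Symb2) : quantHH n (Symb2.swap x) = quantHH n x := by
  refine linearMap_eq_of_mon (f := (quantHH n).comp Symb2.swap.toLinearMap) (f' := quantHH n) ?_ x
  rintro ⟨a, b⟩
  simp only [LinearMap.comp_apply, AlgHom.toLinearMap_apply, Symb2.swap_mon, quantHH_mon]
  rw [slotH_mul_comm, add_comm]

/-- The Leibniz rule turns the derivative into the sum of the momenta. The degree cutoff rises by
one, so a monomial is kept on both sides or on neither. -/
theorem d_quantHH (n : ℕ) (μ : Fin 4) (x : Symb2) :
    d μ (quantHH n x) = quantHH (n + 1) ((Symb2.mom₁ μ + Symb2.mom₂ μ) * x) := by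
  refine linearMap_eq_of_mon (f := (d μ).comp (quantHH n))
    (f' := (quantHH (n + 1)).comp (LinearMap.mulLeft ℂ (Symb2.mom₁ μ + Symb2.mom₂ μ))) ?_ x
  rintro ⟨a, b⟩
  simp only [LinearMap.comp_apply, LinearMap.mulLeft_apply, add_mul, Symb2.mom₁, Symb2.mom₂,
    mon_mul_mon, map_add, Prod.mk_add_mk, quantHH_mon, zero_add, Prod.snd_add, Multiset.card_add,
    Multiset.card_singleton]
  by_cases hn : a.2.card + b.2.card = n
  · rw [if_pos hn, if_pos (by omega), if_pos (by omega)]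
    simp only [d_mul, d_slotH]
  · rw [if_neg hn, if_neg (by omega), if_neg (by omega)]
    simp

theorem quantHH_box₁ (n : ℕ) (x : Symb2) :
    quantHH n (dot Symb2.mom₁ Symb2.mom₁ * x) ∈ eomSubmodule := by
  refine linearMap_mem_of_mon
    (f := (quantHH n).comp (LinearMap.mulLeft ℂ (dot Symb2.mom₁ Symb2.mom₁))) ?_ x
  rintro ⟨a, b⟩
  simp only [LinearMap.comp_apply, LinearMap.mulLeft_apply, dot, Finset.sum_mul, smul_mul_assoc,
    map_sum, map_smul, Symb2.mom₁, mon_mul_mon, Prod.mk_add_mk, quantHH_mon, zero_add, Prod.snd_add,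
    Multiset.card_add, Multiset.card_singleton]
  split_ifs
  · simp only [← smul_mul_assoc, ← Finset.sum_mul]
    exact eom.mul_mem_right _ _ (box_slotH_mem_eom a)
  · simp

/-! ### One field `u` and three fields `h` -/

/-- Symbols of expressions linear in `u` and trilinear in `h`. -/
abbrev Symb4 : Type := AddMonoidAlgebra ℂ ((Slot × Slot) × (Slot × Slot))

/-- The expression `u h h h` with a given symbol of degree `n` in the momenta. -/
def quantU (n : ℕ) : Symb4 →ₗ[ℂ] Jet := umbral fun m =>
  if m.1.1.2.card + m.1.2.2.card + (m.2.1.2.card + m.2.2.2.card) = n then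
    slotU m.1.1 * slotH m.1.2 * (slotH m.2.1 * slotH m.2.2) else 0

theorem quantU_mon (n : ℕ) (a b c e : Slot) : quantU n (mon ((a, b), (c, e))) =
    if a.2.card + b.2.card + (c.2.card + e.2.card) = n then
      slotU a * slotH b * (slotH c * slotH e) else 0 := umbral_mon _ _

namespace Symb4

/-- The polarization of `u`. -/
def pol₀ (μ : Fin 4) : Symb4 := mon ((({μ}, 0), 0), 0)

/-- The momentum of `u`. -/
def mom₀ (μ : Fin 4) : Symb4 := mon (((0, {μ}), 0), 0)

/-- The polarization of the first `h`. -/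
def pol₁ (μ : Fin 4) : Symb4 := mon ((0, ({μ}, 0)), 0)

/-- The momentum of the first `h`. -/
def mom₁ (μ : Fin 4) : Symb4 := mon ((0, (0, {μ})), 0)

/-- The polarization of the second `h`. -/
def pol₂ (μ : Fin 4) : Symb4 := mon (0, (({μ}, 0), 0))

/-- The momentum of the second `h`. -/
def mom₂ (μ : Fin 4) : Symb4 := mon (0, ((0, {μ}), 0))

/-- The polarization of the third `h`. -/
def pol₃ (μ : Fin 4) : Symb4 := mon (0, (0, ({μ}, 0)))

/-- The momentum of the third `h`. -/
def mom₃ (μ : Fin 4) : Symb4 := mon (0, (0, (0, {μ})))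

/-- The total momentum. -/
def total (μ : Fin 4) : Symb4 := mom₀ μ + mom₁ μ + mom₂ μ + mom₃ μ

/-- The exchange of the last two fields. -/
def swap₂₃ : Symb4 →ₐ[ℂ] Symb4 :=
  AddMonoidAlgebra.mapDomainAlgHom ℂ ℂ
    (AddMonoidHom.prodMap (AddMonoidHom.id (Slot × Slot))
      (AddEquiv.prodComm (M := Slot) (N := Slot)).toAddMonoidHom)

theorem swap₂₃_mon (a b c e : Slot) : swap₂₃ (mon ((a, b), (c, e))) = mon ((a, b), (e, c)) := by
  simp [swap₂₃, mon]

/-- The exchange of the first two fields `h`. -/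
def swap₁₂ : Symb4 →ₐ[ℂ] Symb4 :=
  AddMonoidAlgebra.mapDomainAlgHom ℂ ℂ
    (AddEquiv.prodProdProdComm Slot Slot Slot Slot).toAddMonoidHom

theorem swap₁₂_mon (a b c e : Slot) : swap₁₂ (mon ((a, b), (c, e))) = mon ((a, c), (b, e)) := by
  simp [swap₁₂, mon]

end Symb4

open Symb4 in
theorem quantU_swap₂₃ (n : ℕ) (x : Symb4) : quantU n (swap₂₃ x) = quantU n x := by
  refine linearMap_eq_of_mon (f := (quantU n).comp swap₂₃.toLinearMap) (f' := quantU n) ?_ x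
  rintro ⟨⟨a, b⟩, ⟨c, e⟩⟩
  simp only [LinearMap.comp_apply, AlgHom.toLinearMap_apply, swap₂₃_mon, quantU_mon]
  rw [slotH_mul_comm e, add_comm e.2.card]

open Symb4 in
theorem quantU_swap₁₂ (n : ℕ) (x : Symb4) : quantU n (swap₁₂ x) = quantU n x := by
  refine linearMap_eq_of_mon (f := (quantU n).comp swap₁₂.toLinearMap) (f' := quantU n) ?_ x
  rintro ⟨⟨a, b⟩, ⟨c, e⟩⟩
  simp only [LinearMap.comp_apply, AlgHom.toLinearMap_apply, swap₁₂_mon, quantU_mon]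
  rw [add_add_add_comm, mul_assoc, mul_assoc, ← mul_assoc (slotH c), slotH_mul_comm c, mul_assoc]

/-- The degree cutoff built into `quantU` fixes the dimension, four fields plus `n` derivatives,
whatever the symbol; no homogeneity has to be checked. -/
theorem quantU_mem_typed (n : ℕ) (x : Symb4) : quantU n x ∈ typed 3 1 0 (4 + n) := by
  refine linearMap_mem_of_mon ?_ x
  rintro ⟨⟨a, b⟩, ⟨c, e⟩⟩
  rw [quantU_mon]
  split_ifs with hn
  · have := mul_mem_typed (mul_mem_typed (slotU_mem_typed a) (slotH_mem_typed b))
      (mul_mem_typed (slotH_mem_typed c) (slotH_mem_typed e))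
    have e4 : 1 + a.2.card + (1 + b.2.card) + (1 + c.2.card + (1 + e.2.card)) = 4 + n := by omega
    rw [e4] at this
    exact this
  · exact Submodule.zero_mem _

open Symb4 in
theorem d_quantU (n : ℕ) (μ : Fin 4) (x : Symb4) :
    d μ (quantU n x) = quantU (n + 1) (total μ * x) := by
  refine linearMap_eq_of_mon (f := (d μ).comp (quantU n))
    (f' := (quantU (n + 1)).comp (LinearMap.mulLeft ℂ (total μ))) ?_ x
  rintro ⟨⟨a, b⟩, ⟨c, e⟩⟩
  simp only [LinearMap.comp_apply, LinearMap.mulLeft_apply, total, add_mul, mom₀, mom₁, mom₂, mom₃,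
    mon_mul_mon, map_add, Prod.mk_add_mk, quantU_mon, zero_add, Prod.snd_add, Multiset.card_add,
    Multiset.card_singleton]
  by_cases hn : a.2.card + b.2.card + (c.2.card + e.2.card) = n
  · rw [if_pos hn, if_pos (by omega), if_pos (by omega), if_pos (by omega), if_pos (by omega)]
    simp only [d_mul, d_slotH, d_slotU, mul_add, add_mul, add_assoc]
  · rw [if_neg hn, if_neg (by omega), if_neg (by omega), if_neg (by omega), if_neg (by omega)]
    simp

open Symb4 in
theorem quantU_box₀ (n : ℕ) (x : Symb4) : quantU n (dot mom₀ mom₀ * x) ∈ eomSubmodule := by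
  refine linearMap_mem_of_mon
    (f := (quantU n).comp (LinearMap.mulLeft ℂ (dot mom₀ mom₀))) ?_ x
  rintro ⟨⟨a, b⟩, ⟨c, e⟩⟩
  simp only [LinearMap.comp_apply, LinearMap.mulLeft_apply, dot, Finset.sum_mul, smul_mul_assoc,
    map_sum, map_smul, mom₀, mon_mul_mon, Prod.mk_add_mk, quantU_mon, zero_add, Prod.snd_add,
    Multiset.card_add, Multiset.card_singleton]
  split_ifs
  · simp only [← smul_mul_assoc, ← Finset.sum_mul]
    exact eom.mul_mem_right _ _ (eom.mul_mem_right _ _ (box_slotU_mem_eom a))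
  · simp

open Symb4 in
theorem quantU_box₁ (n : ℕ) (x : Symb4) : quantU n (dot mom₁ mom₁ * x) ∈ eomSubmodule := by
  refine linearMap_mem_of_mon
    (f := (quantU n).comp (LinearMap.mulLeft ℂ (dot mom₁ mom₁))) ?_ x
  rintro ⟨⟨a, b⟩, ⟨c, e⟩⟩
  simp only [LinearMap.comp_apply, LinearMap.mulLeft_apply, dot, Finset.sum_mul, smul_mul_assoc,
    map_sum, map_smul, mom₁, mon_mul_mon, Prod.mk_add_mk, quantU_mon, zero_add, Prod.snd_add,
    Multiset.card_add, Multiset.card_singleton]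
  split_ifs
  -- The metric sign is moved onto the middle factor, so that the sum over `μ` becomes the wave
  -- operator on that single field.
  · have hm : ∀ (r : ℂ) (A B C : Jet), r • (A * B * C) = A * (r • B) * C := by
      intro r A B C
      rw [mul_smul_comm, smul_mul_assoc]
    simp only [hm, ← Finset.sum_mul, ← Finset.mul_sum]
    exact eom.mul_mem_right _ _ (eom.mul_mem_left _ _ (box_slotH_mem_eom b))
  · simp

/-! ### Algebra maps on symbols: exchanges of fields and the embedding of bilinear symbols -/

theorem map_dot {R S : Type} [CommRing R] [Algebra ℂ R] [CommRing S] [Algebra ℂ S]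
    (f : R →ₐ[ℂ] S) (a b : Fin 4 → R) :
    f (dot a b) = dot (fun μ => f (a μ)) (fun μ => f (b μ)) := by
  simp only [dot, map_sum, map_smul, map_mul]

namespace Symb4

theorem swap₁₂_pol₀ (μ : Fin 4) : swap₁₂ (pol₀ μ) = pol₀ μ := swap₁₂_mon ({μ}, 0) 0 0 0
theorem swap₁₂_mom₀ (μ : Fin 4) : swap₁₂ (mom₀ μ) = mom₀ μ := swap₁₂_mon (0, {μ}) 0 0 0
theorem swap₁₂_pol₁ (μ : Fin 4) : swap₁₂ (pol₁ μ) = pol₂ μ := swap₁₂_mon 0 ({μ}, 0) 0 0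
theorem swap₁₂_mom₁ (μ : Fin 4) : swap₁₂ (mom₁ μ) = mom₂ μ := swap₁₂_mon 0 (0, {μ}) 0 0
theorem swap₁₂_pol₂ (μ : Fin 4) : swap₁₂ (pol₂ μ) = pol₁ μ := swap₁₂_mon 0 0 ({μ}, 0) 0
theorem swap₁₂_mom₂ (μ : Fin 4) : swap₁₂ (mom₂ μ) = mom₁ μ := swap₁₂_mon 0 0 (0, {μ}) 0
theorem swap₁₂_pol₃ (μ : Fin 4) : swap₁₂ (pol₃ μ) = pol₃ μ := swap₁₂_mon 0 0 0 ({μ}, 0)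
theorem swap₁₂_mom₃ (μ : Fin 4) : swap₁₂ (mom₃ μ) = mom₃ μ := swap₁₂_mon 0 0 0 (0, {μ})
theorem swap₂₃_pol₀ (μ : Fin 4) : swap₂₃ (pol₀ μ) = pol₀ μ := swap₂₃_mon ({μ}, 0) 0 0 0
theorem swap₂₃_mom₀ (μ : Fin 4) : swap₂₃ (mom₀ μ) = mom₀ μ := swap₂₃_mon (0, {μ}) 0 0 0
theorem swap₂₃_pol₁ (μ : Fin 4) : swap₂₃ (pol₁ μ) = pol₁ μ := swap₂₃_mon 0 ({μ}, 0) 0 0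
theorem swap₂₃_mom₁ (μ : Fin 4) : swap₂₃ (mom₁ μ) = mom₁ μ := swap₂₃_mon 0 (0, {μ}) 0 0
theorem swap₂₃_pol₂ (μ : Fin 4) : swap₂₃ (pol₂ μ) = pol₃ μ := swap₂₃_mon 0 0 ({μ}, 0) 0
theorem swap₂₃_mom₂ (μ : Fin 4) : swap₂₃ (mom₂ μ) = mom₃ μ := swap₂₃_mon 0 0 (0, {μ}) 0
theorem swap₂₃_pol₃ (μ : Fin 4) : swap₂₃ (pol₃ μ) = pol₂ μ := swap₂₃_mon 0 0 0 ({μ}, 0)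
theorem swap₂₃_mom₃ (μ : Fin 4) : swap₂₃ (mom₃ μ) = mom₂ μ := swap₂₃_mon 0 0 0 (0, {μ})

end Symb4

namespace Symb2

theorem swap_pol₁ (μ : Fin 4) : swap (pol₁ μ) = pol₂ μ := swap_mon ({μ}, 0) 0
theorem swap_mom₁ (μ : Fin 4) : swap (mom₁ μ) = mom₂ μ := swap_mon (0, {μ}) 0
theorem swap_pol₂ (μ : Fin 4) : swap (pol₂ μ) = pol₁ μ := swap_mon 0 ({μ}, 0)
theorem swap_mom₂ (μ : Fin 4) : swap (mom₂ μ) = mom₁ μ := swap_mon 0 (0, {μ})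

/-- Bilinear symbols as symbols in the last two fields of `u h h h`. -/
def toSymb4 : Symb2 →ₐ[ℂ] Symb4 :=
  AddMonoidAlgebra.mapDomainAlgHom ℂ ℂ (AddMonoidHom.inr (Slot × Slot) (Slot × Slot))

theorem toSymb4_mon (m : Slot × Slot) : toSymb4 (mon m) = mon (0, m) := by
  simp [toSymb4, mon]

theorem toSymb4_pol₁ (μ : Fin 4) : toSymb4 (pol₁ μ) = Symb4.pol₂ μ := toSymb4_mon _
theorem toSymb4_mom₁ (μ : Fin 4) : toSymb4 (mom₁ μ) = Symb4.mom₂ μ := toSymb4_mon _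
theorem toSymb4_pol₂ (μ : Fin 4) : toSymb4 (pol₂ μ) = Symb4.pol₃ μ := toSymb4_mon _
theorem toSymb4_mom₂ (μ : Fin 4) : toSymb4 (mom₂ μ) = Symb4.mom₃ μ := toSymb4_mon _

end Symb2

theorem quantHH_box₂ (n : ℕ) (x : Symb2) :
    quantHH n (dot Symb2.mom₂ Symb2.mom₂ * x) ∈ eomSubmodule := by
  rw [← quantHH_swap, map_mul, map_dot]
  simp only [Symb2.swap_mom₂]
  exact quantHH_box₁ n _

/-- Products correspond to juxtaposed slots: `u` and `h` fill the first two, and their derivatives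
shift the degree cutoff by a constant. -/
theorem u_mul_h_mul_quantHH (ρ α β : Fin 4) (s t : Multiset (Fin 4)) (n : ℕ) (x : Symb2) :
    u ρ s * h α β t * quantHH n x =
      quantU (s.card + t.card + n) (mon ((({ρ}, s), ({α, β}, t)), 0) * Symb2.toSymb4 x) := by
  refine linearMap_eq_of_mon (f := (LinearMap.mulLeft ℂ (u ρ s * h α β t)).comp (quantHH n))
    (f' := ((quantU (s.card + t.card + n)).comp
      (LinearMap.mulLeft ℂ (mon ((({ρ}, s), ({α, β}, t)), 0)))).comp
        Symb2.toSymb4.toLinearMap) ?_ x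
  rintro ⟨a, b⟩
  simp only [LinearMap.comp_apply, LinearMap.mulLeft_apply, AlgHom.toLinearMap_apply,
    Symb2.toSymb4_mon, mon_mul_mon, Prod.mk_add_mk, add_zero, zero_add, quantHH_mon, quantU_mon,
    slotU_single, slotH_pair, add_right_inj]
  split_ifs
  · rfl
  · rw [mul_zero]

open Symb4 in
theorem quantU_box₂ (n : ℕ) (x : Symb4) : quantU n (dot mom₂ mom₂ * x) ∈ eomSubmodule := by
  rw [← quantU_swap₁₂, map_mul, map_dot]
  simp only [swap₁₂_mom₂]
  exact quantU_box₁ n _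

open Symb4 in
theorem quantU_box₃ (n : ℕ) (x : Symb4) : quantU n (dot mom₃ mom₃ * x) ∈ eomSubmodule := by
  rw [← quantU_swap₂₃, map_mul, map_dot]
  simp only [swap₂₃_mom₃]
  exact quantU_box₂ n _

/-! ### Symbols modulo equations of motion and divergences -/

/-- The expressions which are on shell a divergence of a typed current. -/
def divergences : Submodule ℂ Jet where
  carrier := {x | ∃ K : Fin 4 → Jet, (∀ ρ, K ρ ∈ typed 3 1 0 6) ∧ x - ∑ ρ, d ρ (K ρ) ∈ eomSubmodule}
  zero_mem' := ⟨0, fun _ => Submodule.zero_mem _, by simp⟩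
  add_mem' := by
    rintro x y ⟨K, hK, hx⟩ ⟨L, hL, hy⟩
    refine ⟨K + L, fun ρ => Submodule.add_mem _ (hK ρ) (hL ρ), ?_⟩
    have := Submodule.add_mem _ hx hy
    simpa [Finset.sum_add_distrib, add_sub_add_comm] using this
  smul_mem' := by
    rintro c x ⟨K, hK, hx⟩
    refine ⟨c • K, fun ρ => Submodule.smul_mem _ c (hK ρ), ?_⟩
    have := Submodule.smul_mem _ c hx
    simpa [smul_sub, Finset.smul_sum] using this

theorem mem_divergences_of_mem_eom {x : Jet} (hx : x ∈ eomSubmodule) : x ∈ divergences :=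
  ⟨0, fun _ => Submodule.zero_mem _, by simpa using hx⟩

theorem d_mem_divergences (μ : Fin 4) {K : Jet} (hK : K ∈ typed 3 1 0 6) :
    d μ K ∈ divergences := by
  refine ⟨Pi.single μ K, fun ρ => ?_, ?_⟩
  · by_cases hρ : ρ = μ
    · subst hρ; simpa using hK
    · simp [Pi.single_eq_of_ne hρ]
  · rw [Finset.sum_eq_single μ (fun ρ _ hρ => by simp [Pi.single_eq_of_ne hρ]) (by simp)]
    simp

/-- The symbols all of whose multiples are, on shell, divergences. -/
def nullSymbols : Ideal Symb4 where
  carrier := {x | ∀ y, quantU 3 (x * y) ∈ divergences}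
  zero_mem' := by intro y; rw [zero_mul, map_zero]; exact Submodule.zero_mem _
  add_mem' := by
    intro a b ha hb y
    rw [add_mul, map_add]
    exact Submodule.add_mem _ (ha y) (hb y)
  smul_mem' := by
    intro c a ha y
    rw [smul_eq_mul, mul_comm c, mul_assoc]
    exact ha _

theorem quantU_mem_divergences {x : Symb4} (hx : x ∈ nullSymbols) : quantU 3 x ∈ divergences := by
  simpa using hx 1

/-- Momentum conservation modulo divergences. The current is quantized in degree two, hence has
dimension `4 + 2 = 6`. -/
theorem total_mem_nullSymbols (μ : Fin 4) : Symb4.total μ ∈ nullSymbols := by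
  intro y
  rw [← d_quantU]
  exact d_mem_divergences μ (quantU_mem_typed 2 y)

theorem box₀_mem_nullSymbols : dot Symb4.mom₀ Symb4.mom₀ ∈ nullSymbols := fun y =>
  mem_divergences_of_mem_eom (quantU_box₀ 3 y)

theorem box₁_mem_nullSymbols : dot Symb4.mom₁ Symb4.mom₁ ∈ nullSymbols := fun y =>
  mem_divergences_of_mem_eom (quantU_box₁ 3 y)

theorem box₂_mem_nullSymbols : dot Symb4.mom₂ Symb4.mom₂ ∈ nullSymbols := fun y =>
  mem_divergences_of_mem_eom (quantU_box₂ 3 y)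

theorem box₃_mem_nullSymbols : dot Symb4.mom₃ Symb4.mom₃ ∈ nullSymbols := fun y =>
  mem_divergences_of_mem_eom (quantU_box₃ 3 y)
/-! ### Algebra of Minkowski products -/

section
variable {R : Type} [CommRing R] [Algebra ℂ R]

theorem dot_comm (a b : Fin 4 → R) : dot a b = dot b a := by
  simp only [dot, mul_comm]

theorem dot_add (a b c : Fin 4 → R) : dot a (b + c) = dot a b + dot a c := by
  simp only [dot, Pi.add_apply, mul_add, smul_add, Finset.sum_add_distrib]

theorem add_dot (a b c : Fin 4 → R) : dot (a + b) c = dot a c + dot b c := by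
  simp only [dot, Pi.add_apply, add_mul, smul_add, Finset.sum_add_distrib]

theorem neg_dot (a b : Fin 4 → R) : dot (-a) b = -dot a b := by
  simp only [dot, Pi.neg_apply, neg_mul, smul_neg, Finset.sum_neg_distrib]

theorem dot_neg (a b : Fin 4 → R) : dot a (-b) = -dot a b := by
  simp only [dot, Pi.neg_apply, mul_neg, smul_neg, Finset.sum_neg_distrib]

/-- The contraction of `N₀`, evaluated on vectors in place of its ten indices. -/
def n0Dot (a b c e f i k p q l : Fin 4 → R) : R :=
  -16 * (dot a f * dot b i * dot c k * dot e l * dot p q)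
  + 8 * (dot a f * dot b i * dot c p * dot e q * dot k l)
  + 32 * (dot a p * dot b c * dot e f * dot k q * dot i l)
  + 32 * (dot a k * dot b l * dot c f * dot e p * dot i q)
  - 32 * (dot a f * dot b c * dot e p * dot k l * dot i q)
  - 16 * (dot a f * dot b p * dot c i * dot e q * dot k l)
  + 16 * (dot a f * dot b c * dot e i * dot k l * dot p q)

/-- `n0Dot` with the indices of its first field contracted with the metric. -/
def n0Tr1 (c e f i k p q l : Fin 4 → R) : R :=
  -16 * (dot f i * dot c k * dot e l * dot p q)
  + 8 * (dot f i * dot c p * dot e q * dot k l)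
  + 32 * (dot p c * dot e f * dot k q * dot i l)
  + 32 * (dot k l * dot c f * dot e p * dot i q)
  - 32 * (dot f c * dot e p * dot k l * dot i q)
  - 16 * (dot f p * dot c i * dot e q * dot k l)
  + 16 * (dot f c * dot e i * dot k l * dot p q)

/-- `n0Dot` with the indices of its second field contracted with the metric. -/
def n0Tr2 (a b f i k p q l : Fin 4 → R) : R :=
  -16 * (dot a f * dot b i * dot k l * dot p q)
  + 8 * (dot a f * dot b i * dot p q * dot k l)
  + 32 * (dot a p * dot b f * dot k q * dot i l)
  + 32 * (dot a k * dot b l * dot f p * dot i q)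
  - 32 * (dot a f * dot b p * dot k l * dot i q)
  - 16 * (dot a f * dot b p * dot i q * dot k l)
  + 16 * (dot a f * dot b i * dot k l * dot p q)

/-- `n0Dot` with the indices of its third field contracted with the metric. -/
def n0Tr3 (a b c e k p q l : Fin 4 → R) : R :=
  -16 * (dot a b * dot c k * dot e l * dot p q)
  + 8 * (dot a b * dot c p * dot e q * dot k l)
  + 32 * (dot a p * dot b c * dot e l * dot k q)
  + 32 * (dot a k * dot b l * dot c q * dot e p)
  - 32 * (dot a q * dot b c * dot e p * dot k l)
  - 16 * (dot a c * dot b p * dot e q * dot k l)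
  + 16 * (dot a e * dot b c * dot k l * dot p q)

/-- `n0Dot` with the indices of its fourth field contracted with the metric. -/
def n0Tr4 (a b c e f i k l : Fin 4 → R) : R :=
  -64 * (dot a f * dot b i * dot c k * dot e l)
  + 8 * (dot a f * dot b i * dot c e * dot k l)
  + 32 * (dot a k * dot b c * dot e f * dot i l)
  + 32 * (dot a k * dot b l * dot c f * dot e i)
  - 32 * (dot a f * dot b c * dot e i * dot k l)
  - 16 * (dot a f * dot b e * dot c i * dot k l)
  + 64 * (dot a f * dot b c * dot e i * dot k l)

theorem dot_four (a b : Fin 4 → R) :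
    dot a b = a 0 * b 0 - a 1 * b 1 - a 2 * b 2 - a 3 * b 3 := by
  simp [dot, Fin.sum_univ_four, g]
  ring

/-- The coordinate vectors: `dot (basisVec x) a = a x`. -/
def basisVec (x : Fin 4) : Fin 4 → R := fun α => algebraMap ℂ R (η x α)

theorem basisVec_dot (x : Fin 4) (a : Fin 4 → R) : dot (basisVec x) a = a x := by
  rw [dot, Finset.sum_eq_single x]
  · rw [basisVec, η, if_pos rfl, ← Algebra.smul_def, smul_smul, g_mul_self, one_smul]
  · intro y _ hy
    simp [basisVec, η, Ne.symm hy]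
  · simp

theorem dot_basisVec (x : Fin 4) (a : Fin 4 → R) : dot a (basisVec x) = a x := by
  rw [dot_comm, basisVec_dot]

theorem basisVec_apply_self (x : Fin 4) : (basisVec x : Fin 4 → R) x = algebraMap ℂ R (g x) := by
  rw [basisVec, η, if_pos rfl]

/-- Completeness of the coordinate vectors writes the metric as a sum of product tensors, which
reduces its contractions to those of vectors. -/
theorem η_eq_sum (α β : Fin 4) :
    algebraMap ℂ R (η α β) = ∑ x, g x • ((basisVec x : Fin 4 → R) α * basisVec x β) := by
  have := basisVec_dot α (basisVec β : Fin 4 → R)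
  rw [basisVec, η_comm] at this
  rw [← this, dot]
  refine Finset.sum_congr rfl fun x _ => ?_
  rw [basisVec, basisVec, basisVec, basisVec, η_comm α x, η_comm β x]

/-! ### Contractions of five pairs of indices -/

section Contraction
variable {V W : Type} [AddCommGroup V] [Module ℂ V] [AddCommGroup W] [Module ℂ W]

/-- The contraction of five pairs of indices. -/
def contr5 (F : Fin 4 → Fin 4 → Fin 4 → Fin 4 → Fin 4 → V) : V :=
  ∑ a, ∑ b, ∑ c, ∑ e, ∑ f, (g a * g b * g c * g e * g f) • F a b c e f

/-- On a product tensor the five sums separate, one Minkowski product per contracted pair. -/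
theorem contr5_eq {F : Fin 4 → Fin 4 → Fin 4 → Fin 4 → Fin 4 → R}
    (x₁ y₁ x₂ y₂ x₃ y₃ x₄ y₄ x₅ y₅ : Fin 4 → R)
    (H : ∀ a b c e f, F a b c e f =
      x₁ a * y₁ a * (x₂ b * y₂ b) * (x₃ c * y₃ c) * (x₄ e * y₄ e) * (x₅ f * y₅ f)) :
    contr5 F = dot x₁ y₁ * dot x₂ y₂ * dot x₃ y₃ * dot x₄ y₄ * dot x₅ y₅ := by
  have : ∀ a b c e f, (g a * g b * g c * g e * g f) • F a b c e f =
      (g a • (x₁ a * y₁ a)) * (g b • (x₂ b * y₂ b)) * (g c • (x₃ c * y₃ c)) *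
        (g e • (x₄ e * y₄ e)) * (g f • (x₅ f * y₅ f)) := by
    intro a b c e f
    rw [H]
    simp only [Algebra.smul_def, map_mul]
    ring
  simp only [contr5, this, ← Finset.mul_sum, ← Finset.sum_mul, dot]

theorem contr5_add (F G : Fin 4 → Fin 4 → Fin 4 → Fin 4 → Fin 4 → V) :
    contr5 (fun a b c e f => F a b c e f + G a b c e f) = contr5 F + contr5 G := by
  simp only [contr5, smul_add, Finset.sum_add_distrib]

theorem contr5_map (L : V →ₗ[ℂ] W) (F : Fin 4 → Fin 4 → Fin 4 → Fin 4 → Fin 4 → V) :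
    contr5 (fun a b c e f => L (F a b c e f)) = L (contr5 F) := by
  simp only [contr5, map_sum, map_smul]

/-- The contraction which defines `N₀`, applied to a tensor with ten indices. -/
def n0Form (f : Fin 4 → Fin 4 → Fin 4 → Fin 4 → Fin 4 → Fin 4 → Fin 4 → Fin 4 → Fin 4 → Fin 4 → V) :
    V :=
  (-16 : ℂ) • contr5 (fun μ ν ρ σ x => f μ ν ρ σ μ ν ρ x x σ)
  + (8 : ℂ) • contr5 (fun μ ν ρ σ l => f μ ν ρ σ μ ν l ρ σ l)
  + (32 : ℂ) • contr5 (fun μ ν ρ α β => f μ ν ν ρ ρ β α μ α β)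
  + (32 : ℂ) • contr5 (fun μ ν ρ σ α => f μ ν ρ σ ρ α μ σ α ν)
  + (-32 : ℂ) • contr5 (fun μ ν ρ α β => f μ ν ν ρ μ β α ρ β α)
  + (-16 : ℂ) • contr5 (fun μ ν ρ σ l => f μ ν ρ σ μ ρ l ν σ l)
  + (16 : ℂ) • contr5 (fun μ ν ρ l x => f μ ν ν ρ μ ρ l x x l)

/-- Lets `dQ` and `quantU` pass through the contraction, so that they need to be known only on a
single product of four fields. -/
theorem n0Form_map (L : V →ₗ[ℂ] W)
    (f : Fin 4 → Fin 4 → Fin 4 → Fin 4 → Fin 4 → Fin 4 → Fin 4 → Fin 4 → Fin 4 → Fin 4 → V) :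
    n0Form (fun α β ρ σ κ τ γ φ χ δ => L (f α β ρ σ κ τ γ φ χ δ)) = L (n0Form f) := by
  simp only [n0Form, contr5_map, map_add, map_smul]

theorem n0Form_add
    (f f' : Fin 4 → Fin 4 → Fin 4 → Fin 4 → Fin 4 → Fin 4 → Fin 4 → Fin 4 → Fin 4 → Fin 4 → V) :
    n0Form (fun α β ρ σ κ τ γ φ χ δ => f α β ρ σ κ τ γ φ χ δ + f' α β ρ σ κ τ γ φ χ δ) =
      n0Form f + n0Form f' := by
  simp only [n0Form, contr5_add, smul_add]
  abel

theorem n0Form_smul (c : ℂ)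
    (f : Fin 4 → Fin 4 → Fin 4 → Fin 4 → Fin 4 → Fin 4 → Fin 4 → Fin 4 → Fin 4 → Fin 4 → V) :
    n0Form (fun α β ρ σ κ τ γ φ χ δ => c • f α β ρ σ κ τ γ φ χ δ) = c • n0Form f := by
  simpa only [LinearMap.lsmul_apply] using n0Form_map (LinearMap.lsmul ℂ V c) f

theorem n0Form_mul (r : R)
    (f : Fin 4 → Fin 4 → Fin 4 → Fin 4 → Fin 4 → Fin 4 → Fin 4 → Fin 4 → Fin 4 → Fin 4 → R) :
    n0Form (fun α β ρ σ κ τ γ φ χ δ => r * f α β ρ σ κ τ γ φ χ δ) = r * n0Form f := by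
  simpa only [LinearMap.mulLeft_apply] using n0Form_map (LinearMap.mulLeft ℂ r) f

theorem n0Form_sum {ι : Type} (t : Finset ι)
    (f : ι → Fin 4 → Fin 4 → Fin 4 → Fin 4 → Fin 4 → Fin 4 → Fin 4 → Fin 4 → Fin 4 → Fin 4 → V) :
    n0Form (fun α β ρ σ κ τ γ φ χ δ => ∑ x ∈ t, f x α β ρ σ κ τ γ φ χ δ) =
      ∑ x ∈ t, n0Form (f x) := by
  classical
  induction t using Finset.induction_on with
  | empty => simp [n0Form, contr5]
  | insert x t hx ih => simp only [Finset.sum_insert hx, n0Form_add, ih]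

end Contraction

theorem n0Form_dot (a b c e f i k p q l : Fin 4 → R) :
    n0Form (fun α β ρ σ κ τ γ φ χ δ =>
      a α * b β * (c ρ * e σ) * (f κ * i τ * k γ) * (p φ * q χ * l δ)) =
        n0Dot a b c e f i k p q l := by
  simp only [n0Form]
  rw [contr5_eq a f b i c k e l p q (by intros; ring), contr5_eq a f b i c p e q k l (by intros; ring),
    contr5_eq a p b c e f k q i l (by intros; ring), contr5_eq a k b l c f e p i q (by intros; ring),
    contr5_eq a f b c e p k l i q (by intros; ring), contr5_eq a f b p c i e q k l (by intros; ring),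
    contr5_eq a f b c e i k l p q (by intros; ring)]
  simp only [n0Dot, Algebra.smul_def, map_neg, map_ofNat]
  ring

/-- The symbol of the gauge variation of `N₀`, up to a constant: `v`, `q` belong to `u`, the `p` and
`k` to the three remaining fields `h`. -/
def n0Var (v q p₁ p₂ k₂ p₃ k₃ : Fin 4 → R) : R :=
  (n0Dot q v p₁ p₁ p₂ p₂ k₂ p₃ p₃ k₃ + n0Dot v q p₁ p₁ p₂ p₂ k₂ p₃ p₃ k₃
    - dot q v * n0Tr1 p₁ p₁ p₂ p₂ k₂ p₃ p₃ k₃)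
  + (n0Dot p₁ p₁ q v p₂ p₂ k₂ p₃ p₃ k₃ + n0Dot p₁ p₁ v q p₂ p₂ k₂ p₃ p₃ k₃
    - dot q v * n0Tr2 p₁ p₁ p₂ p₂ k₂ p₃ p₃ k₃)
  + (n0Dot p₁ p₁ p₂ p₂ q v q p₃ p₃ k₃ + n0Dot p₁ p₁ p₂ p₂ v q q p₃ p₃ k₃
    - dot q v * n0Tr3 p₁ p₁ p₂ p₂ q p₃ p₃ k₃)
  + (n0Dot p₁ p₁ p₂ p₂ p₃ p₃ k₃ q v q + n0Dot p₁ p₁ p₂ p₂ p₃ p₃ k₃ v q q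
    - dot q v * n0Tr4 p₁ p₁ p₂ p₂ p₃ p₃ k₃ q)

/-- The symbol of `calD`. -/
def calDDot (p₂ k₂ p₃ k₃ : Fin 4 → R) : R :=
  2 * (dot p₂ k₂ * dot p₂ k₃ * dot p₃ p₃ + dot p₂ k₃ * dot p₂ k₃ * dot p₃ p₃
    - dot p₂ p₃ * dot p₂ p₃ * dot k₂ k₃)

/-- The symbol of `calDD`, contracted with two vectors. -/
def calDDDot (a b p₂ k₂ p₃ k₃ : Fin 4 → R) : R :=
  -(dot p₂ p₂ * dot p₃ p₃ * dot k₂ a * dot k₃ b)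
  + 2 * (dot p₂ p₃ * dot p₂ p₃ * dot k₂ a * dot k₃ b)
  + 4 * (dot p₂ a * dot p₂ k₃ * dot p₃ b * dot p₃ k₂ + dot p₂ a * dot p₃ b * dot p₂ p₃ * dot k₂ k₃)
  - 4 * (dot p₂ k₂ * dot p₂ k₃ * dot p₃ a * dot p₃ b + dot p₂ k₃ * dot p₂ k₃ * dot p₃ a * dot p₃ b)
  - 4 * (dot p₂ a * dot p₂ p₃ * dot p₃ k₂ * dot k₃ b + dot p₂ b * dot p₂ p₃ * dot p₃ k₂ * dot k₃ a
      + dot p₂ a * dot p₂ p₃ * dot p₃ k₃ * dot k₃ b + dot p₂ b * dot p₂ p₃ * dot p₃ k₃ * dot k₃ a)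

/-- The symbol of the anomaly. -/
def anomalyDot (v q p₁ k₁ p₂ k₂ p₃ k₃ : Fin 4 → R) : R :=
  4 * ((dot v k₁ + dot v q) * (dot p₁ p₁ * calDDot p₂ k₂ p₃ k₃ + calDDDot p₁ p₁ p₂ k₂ p₃ k₃))
  - 8 * (dot q p₁ * (dot v p₁ * calDDot p₂ k₂ p₃ k₃ + calDDDot v p₁ p₂ k₂ p₃ k₃))

/-- The obstruction to the cancellation of the anomaly before symmetrization. -/
def defect (v q p₁ k₁ p₂ k₂ p₃ k₃ : Fin 4 → R) : R :=
  n0Var v q p₁ p₂ k₂ p₃ k₃ + 2 * anomalyDot v q p₁ k₁ p₂ k₂ p₃ k₃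

/-- The computational core, which tests the seven coefficients of `N₀` against the anomaly. The six
terms are the permutations of the three fields `h`. Conservation eliminates `q`, masslessness the
squares, and `h₂₃` one more product; what remains is a polynomial identity. -/
theorem sum_defect (v q p₁ k₁ p₂ k₂ p₃ k₃ : Fin 4 → R) (hq : q = -(k₁ + k₂ + k₃))
    (h₁ : dot k₁ k₁ = 0) (h₂ : dot k₂ k₂ = 0) (h₃ : dot k₃ k₃ = 0)
    (h₂₃ : dot k₂ k₃ = -dot k₁ k₂ - dot k₁ k₃) :
    defect v q p₁ k₁ p₂ k₂ p₃ k₃ + defect v q p₁ k₁ p₃ k₃ p₂ k₂ + defect v q p₂ k₂ p₁ k₁ p₃ k₃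
    + defect v q p₂ k₂ p₃ k₃ p₁ k₁ + defect v q p₃ k₃ p₁ k₁ p₂ k₂
    + defect v q p₃ k₃ p₂ k₂ p₁ k₁ = 0 := by
  subst hq
  -- Each product is written in one fixed order, so that `ring` sees a single unknown per pair of
  -- vectors.
  simp only [defect, n0Var, anomalyDot, calDDot, calDDDot, n0Dot, n0Tr1, n0Tr2, n0Tr3, n0Tr4,
    add_dot, dot_add, neg_dot, dot_neg, h₁, h₂, h₃, h₂₃, dot_comm p₁ v, dot_comm p₂ v, dot_comm p₃ v,
    dot_comm k₁ v, dot_comm k₂ v, dot_comm k₃ v, dot_comm p₂ p₁, dot_comm p₃ p₁, dot_comm p₃ p₂,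
    dot_comm k₁ p₁, dot_comm k₁ p₂, dot_comm k₁ p₃, dot_comm k₂ p₁, dot_comm k₂ p₂, dot_comm k₂ p₃,
    dot_comm k₃ p₁, dot_comm k₃ p₂, dot_comm k₃ p₃, dot_comm k₂ k₁, dot_comm k₃ k₁, dot_comm k₃ k₂]
  ring

end
/-! ### The gauge variation of `N₀` -/

section
variable {R : Type} [CommRing R] [Algebra ℂ R]

theorem n0Form_trace₁ (c e f i k p q l : Fin 4 → R) :
    n0Form (fun α β ρ σ κ τ γ φ χ δ =>
      algebraMap ℂ R (η α β) * (c ρ * e σ) * (f κ * i τ * k γ) * (p φ * q χ * l δ)) =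
        n0Tr1 c e f i k p q l := by
  simp only [η_eq_sum, Finset.sum_mul, smul_mul_assoc]
  rw [n0Form_sum]
  refine (Finset.sum_congr rfl fun x _ => (n0Form_smul (g x) _).trans (congrArg _
    (n0Form_dot (basisVec x) (basisVec x) c e f i k p q l))).trans ?_
  simp only [n0Dot, n0Tr1, basisVec_dot, Fin.sum_univ_four, dot_four f i,
    dot_four p c, dot_four k l, dot_four f c, dot_four f p]
  simp [g]
  ring

theorem n0Form_trace₂ (a b f i k p q l : Fin 4 → R) :
    n0Form (fun α β ρ σ κ τ γ φ χ δ =>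
      a α * b β * algebraMap ℂ R (η ρ σ) * (f κ * i τ * k γ) * (p φ * q χ * l δ)) =
        n0Tr2 a b f i k p q l := by
  simp only [η_eq_sum, Finset.sum_mul, Finset.mul_sum, mul_smul_comm, smul_mul_assoc]
  rw [n0Form_sum]
  refine (Finset.sum_congr rfl fun x _ => (n0Form_smul (g x) _).trans (congrArg _
    (n0Form_dot a b (basisVec x) (basisVec x) f i k p q l))).trans ?_
  simp only [n0Dot, n0Tr2, basisVec_dot, dot_basisVec, Fin.sum_univ_four, dot_four k l,
    dot_four p q, dot_four b f, dot_four f p, dot_four b p, dot_four i q, dot_four b i]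
  simp [g]
  ring

theorem n0Form_trace₃ (a b c e k p q l : Fin 4 → R) :
    n0Form (fun α β ρ σ κ τ γ φ χ δ =>
      a α * b β * (c ρ * e σ) * (algebraMap ℂ R (η κ τ) * k γ) * (p φ * q χ * l δ)) =
        n0Tr3 a b c e k p q l := by
  simp only [η_eq_sum, Finset.sum_mul, Finset.mul_sum, mul_smul_comm, smul_mul_assoc]
  rw [n0Form_sum]
  refine (Finset.sum_congr rfl fun x _ => (n0Form_smul (g x) _).trans (congrArg _
    (n0Form_dot a b c e (basisVec x) (basisVec x) k p q l))).trans ?_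
  simp only [n0Dot, n0Tr3, basisVec_dot, dot_basisVec, Fin.sum_univ_four, dot_four a b,
    dot_four e l, dot_four c q, dot_four a q, dot_four a c, dot_four a e]
  simp [g]
  ring

/-- In the first and last terms of `N₀` the fourth field occurs through its trace; the trace of the
metric is `4`, which turns `16` into `64`. -/
theorem n0Form_trace₄ (a b c e f i k l : Fin 4 → R) :
    n0Form (fun α β ρ σ κ τ γ φ χ δ =>
      a α * b β * (c ρ * e σ) * (f κ * i τ * k γ) * (algebraMap ℂ R (η φ χ) * l δ)) =
        n0Tr4 a b c e f i k l := by
  simp only [η_eq_sum, Finset.sum_mul, Finset.mul_sum, mul_smul_comm, smul_mul_assoc]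
  rw [n0Form_sum]
  refine (Finset.sum_congr rfl fun x _ => (n0Form_smul (g x) _).trans (congrArg _
    (n0Form_dot a b c e f i k (basisVec x) (basisVec x) l))).trans ?_
  simp only [n0Dot, n0Tr4, dot_basisVec, basisVec_apply_self, Fin.sum_univ_four,
    dot_four c e, dot_four a k, dot_four e i, dot_four b e]
  simp [g]
  ring

/-- Linearity in the varied field, whose gauge symbol has three pieces: two orderings of momentum
and polarization, and a metric term weighted by their product `r`. -/
theorem n0Form_gauge
    {F A B Z : Fin 4 → Fin 4 → Fin 4 → Fin 4 → Fin 4 → Fin 4 → Fin 4 → Fin 4 → Fin 4 → Fin 4 → R}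
    {r x y z : R} (hA : n0Form A = x) (hB : n0Form B = y) (hZ : n0Form Z = z)
    (H : ∀ α β ρ σ κ τ γ φ χ δ, F α β ρ σ κ τ γ φ χ δ =
      A α β ρ σ κ τ γ φ χ δ + B α β ρ σ κ τ γ φ χ δ + -r * Z α β ρ σ κ τ γ φ χ δ) :
    n0Form F = x + y - r * z := by
  have hF : F = fun α β ρ σ κ τ γ φ χ δ =>
      A α β ρ σ κ τ γ φ χ δ + B α β ρ σ κ τ γ φ χ δ + -r * Z α β ρ σ κ τ γ φ χ δ := by
    funext α β ρ σ κ τ γ φ χ δ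
    exact H ..
  rw [hF, n0Form_add, n0Form_add, n0Form_mul, hA, hB, hZ]
  ring

end

theorem N0_eq_n0Form : N0 = n0Form fun α β ρ σ κ τ γ φ χ δ =>
    h α β 0 * h ρ σ 0 * h κ τ {γ} * h φ χ {δ} := by
  simp only [N0, n0Form, contr5, trh, Finset.mul_sum, mul_smul_comm, Finset.smul_sum, smul_smul,
    mul_assoc]

section
open Symb4

/-- The symbol of `2 i d_Q h_{αβ}`. -/
def gaugeSymb (α β : Fin 4) : Symb4 :=
  mom₀ α * pol₀ β + pol₀ α * mom₀ β - algebraMap ℂ Symb4 (η α β) * dot mom₀ pol₀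

/-- The ghost inherits the derivatives `s` of the varied field; the extra `1` in the degree is the
derivative created by `d_Q`. -/
theorem dQ_h_mul_hhh (α β ρ σ κ τ φ χ : Fin 4) (s t w z : Multiset (Fin 4)) (n : ℕ)
    (hn : s.card + t.card + (w.card + z.card) + 1 = n) :
    dQ (h α β s) * h ρ σ t * (h κ τ w * h φ χ z) = (-(Complex.I / 2)) •
      quantU n (gaugeSymb α β * mon (((0, s), ({ρ, σ}, t)), (({κ, τ}, w), ({φ, χ}, z)))) := by
  have key : ∀ μ ν : Fin 4, u ν (μ ::ₘ s) * h ρ σ t * (h κ τ w * h φ χ z) =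
      quantU n (mom₀ μ * pol₀ ν * mon (((0, s), ({ρ, σ}, t)), (({κ, τ}, w), ({φ, χ}, z)))) := by
    intro μ ν
    simp only [mom₀, pol₀, mon_mul_mon, Prod.mk_add_mk, add_zero, zero_add, quantU_mon]
    rw [if_pos (by simp; omega), slotH_pair, slotH_pair, slotH_pair, slotU_single,
      Multiset.singleton_add]
  rw [dQ_h, gaugeSymb, sub_mul, add_mul, map_sub, map_add, mul_comm (pol₀ α), ← key, ← key,
    mul_assoc (algebraMap ℂ Symb4 _), ← Algebra.smul_def, map_smul, dot, Finset.sum_mul, map_sum]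
  simp only [smul_mul_assoc, map_smul, ← key]
  simp only [sub_mul, add_mul, Finset.sum_mul, smul_mul_assoc]

/-- The fields `h` are even and central, so each variation moves to the front without a sign, as the
slot order of `quantU` requires. -/
theorem dQ_hhhh (A B C E : Jet) (a b c e f i : Fin 4) (s t w : Multiset (Fin 4))
    (hA : A = h a b s) (hB : B = h c e t) (hC : C = h f i w) :
    dQ (A * B * C * E) = dQ A * B * (C * E) + dQ B * A * (C * E) + dQ C * A * (B * E)
      + dQ E * A * (B * C) := by
  have cA : ∀ x, A * x = x * A := fun x => hA ▸ h_mul_comm _ _ _ x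
  have cB : ∀ x, B * x = x * B := fun x => hB ▸ h_mul_comm _ _ _ x
  have cC : ∀ x, C * x = x * C := fun x => hC ▸ h_mul_comm _ _ _ x
  have tA : twist true A = A := hA ▸ twist_h _ _ _ _
  have tB : twist true B = B := hB ▸ twist_h _ _ _ _
  have tC : twist true C = C := hC ▸ twist_h _ _ _ _
  have cAB : ∀ x, A * B * x = x * A * B := fun x => by rw [mul_assoc, cB, ← mul_assoc, cA]
  have cABC : ∀ x, A * B * C * x = x * A * B * C := fun x => by rw [mul_assoc, cC, ← mul_assoc, cAB]
  simp only [dQ_mul, map_mul, tA, tB, tC, add_mul]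
  rw [cA (dQ B), cAB (dQ C), cABC (dQ E)]
  simp only [mul_assoc]

theorem dQ_N0 : dQ N0 = (-(Complex.I / 2)) •
    quantU 3 (n0Var pol₀ mom₀ pol₁ pol₂ mom₂ pol₃ mom₃) := by
  have e₁ : ∀ α β ρ σ κ τ γ φ χ δ : Fin 4,
      dQ (h α β 0 * h ρ σ 0 * h κ τ {γ} * h φ χ {δ}) = (-(Complex.I / 2)) • quantU 3
        (gaugeSymb α β * mon (((0, 0), ({ρ, σ}, 0)), (({κ, τ}, {γ}), ({φ, χ}, {δ})))
        + gaugeSymb ρ σ * mon (((0, 0), ({α, β}, 0)), (({κ, τ}, {γ}), ({φ, χ}, {δ})))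
        + gaugeSymb κ τ * mon (((0, {γ}), ({α, β}, 0)), (({ρ, σ}, 0), ({φ, χ}, {δ})))
        + gaugeSymb φ χ * mon (((0, {δ}), ({α, β}, 0)), (({ρ, σ}, 0), ({κ, τ}, {γ})))) := by
    intro α β ρ σ κ τ γ φ χ δ
    rw [dQ_hhhh _ _ _ _ _ _ _ _ _ _ _ _ _ rfl rfl rfl,
      dQ_h_mul_hhh _ _ _ _ _ _ _ _ _ _ _ _ 3 (by simp), dQ_h_mul_hhh _ _ _ _ _ _ _ _ _ _ _ _ 3 (by simp),
      dQ_h_mul_hhh _ _ _ _ _ _ _ _ _ _ _ _ 3 (by simp), dQ_h_mul_hhh _ _ _ _ _ _ _ _ _ _ _ _ 3 (by simp),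
      map_add, map_add, map_add, smul_add, smul_add, smul_add]
  rw [N0_eq_n0Form, ← n0Form_map]
  simp only [e₁]
  rw [n0Form_smul, n0Form_map]
  congr 2
  rw [n0Form_add, n0Form_add, n0Form_add, n0Var]
  -- If an undifferentiated field is varied (`m₁`), two differentiated ones remain and fill the last
  -- two slots. If a differentiated one is varied (`m₂`), its derivative becomes a ghost momentum
  -- and only the last slot keeps one.
  have m₁ : ∀ ρ σ κ τ γ φ χ δ : Fin 4,
      (mon (((0, 0), ({ρ, σ}, 0)), (({κ, τ}, {γ}), ({φ, χ}, {δ}))) : Symb4) =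
        pol₁ ρ * pol₁ σ * (pol₂ κ * pol₂ τ * mom₂ γ) * (pol₃ φ * pol₃ χ * mom₃ δ) := by
    intros
    simp [pol₁, pol₂, mom₂, pol₃, mom₃, mon_mul_mon, Multiset.insert_eq_cons]
    rfl
  have m₂ : ∀ α β γ ρ σ φ χ δ : Fin 4,
      (mon (((0, {γ}), ({α, β}, 0)), (({ρ, σ}, 0), ({φ, χ}, {δ}))) : Symb4) =
        mom₀ γ * (pol₁ α * pol₁ β) * (pol₂ ρ * pol₂ σ) * (pol₃ φ * pol₃ χ * mom₃ δ) := by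
    intros
    simp [pol₁, pol₂, mom₀, pol₃, mom₃, mon_mul_mon, Multiset.insert_eq_cons]
  congr 1
  · congr 1
    · congr 1
      · refine n0Form_gauge (n0Form_dot mom₀ pol₀ pol₁ pol₁ pol₂ pol₂ mom₂ pol₃ pol₃ mom₃)
          (n0Form_dot pol₀ mom₀ pol₁ pol₁ pol₂ pol₂ mom₂ pol₃ pol₃ mom₃)
          (n0Form_trace₁ pol₁ pol₁ pol₂ pol₂ mom₂ pol₃ pol₃ mom₃) ?_
        intros
        simp only [gaugeSymb, m₁]
        ring
      · refine n0Form_gauge (n0Form_dot pol₁ pol₁ mom₀ pol₀ pol₂ pol₂ mom₂ pol₃ pol₃ mom₃)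
          (n0Form_dot pol₁ pol₁ pol₀ mom₀ pol₂ pol₂ mom₂ pol₃ pol₃ mom₃)
          (n0Form_trace₂ pol₁ pol₁ pol₂ pol₂ mom₂ pol₃ pol₃ mom₃) ?_
        intros
        simp only [gaugeSymb, m₁]
        ring
    · refine n0Form_gauge (n0Form_dot pol₁ pol₁ pol₂ pol₂ mom₀ pol₀ mom₀ pol₃ pol₃ mom₃)
        (n0Form_dot pol₁ pol₁ pol₂ pol₂ pol₀ mom₀ mom₀ pol₃ pol₃ mom₃)
        (n0Form_trace₃ pol₁ pol₁ pol₂ pol₂ mom₀ pol₃ pol₃ mom₃) ?_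
      intros
      simp only [gaugeSymb, m₂]
      ring
  · refine n0Form_gauge (n0Form_dot pol₁ pol₁ pol₂ pol₂ pol₃ pol₃ mom₃ mom₀ pol₀ mom₀)
      (n0Form_dot pol₁ pol₁ pol₂ pol₂ pol₃ pol₃ mom₃ pol₀ mom₀ mom₀)
      (n0Form_trace₄ pol₁ pol₁ pol₂ pol₂ pol₃ pol₃ mom₃ mom₀) ?_
    intros
    simp only [gaugeSymb, m₂]
    ring

end

/-! ### The Euler derivative of the cubic Lagrangian in `h` -/

section Contraction
variable {V W : Type} [AddCommGroup V] [Module ℂ V] [AddCommGroup W] [Module ℂ W]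
variable {R : Type} [CommRing R] [Algebra ℂ R]

/-- The contraction of two pairs of indices. -/
def contr2 (F : Fin 4 → Fin 4 → V) : V := ∑ a, ∑ b, (g a * g b) • F a b

/-- The contraction of three pairs of indices. -/
def contr3 (F : Fin 4 → Fin 4 → Fin 4 → V) : V :=
  ∑ a, ∑ b, ∑ c, (g a * g b * g c) • F a b c

/-- The contraction of four pairs of indices. -/
def contr4 (F : Fin 4 → Fin 4 → Fin 4 → Fin 4 → V) : V :=
  ∑ a, ∑ b, ∑ c, ∑ e, (g a * g b * g c * g e) • F a b c e

theorem contr2_map_eq (L : R →ₗ[ℂ] V) {F : Fin 4 → Fin 4 → V} (r : R) (x₁ y₁ x₂ y₂ : Fin 4 → R)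
    (H : ∀ a b, F a b = L (r * (x₁ a * y₁ a) * (x₂ b * y₂ b))) :
    contr2 F = L (r * dot x₁ y₁ * dot x₂ y₂) := by
  have : ∀ a b, (g a * g b) • F a b =
      L (r * (g a • (x₁ a * y₁ a)) * (g b • (x₂ b * y₂ b))) := by
    intro a b
    rw [H, ← map_smul]
    simp only [Algebra.smul_def, map_mul]
    congr 1
    ring
  simp only [contr2, this, ← map_sum, ← Finset.mul_sum, ← Finset.sum_mul, dot]

theorem contr3_map_eq (L : R →ₗ[ℂ] V) {F : Fin 4 → Fin 4 → Fin 4 → V}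
    (x₁ y₁ x₂ y₂ x₃ y₃ : Fin 4 → R)
    (H : ∀ a b c, F a b c = L (x₁ a * y₁ a * (x₂ b * y₂ b) * (x₃ c * y₃ c))) :
    contr3 F = L (dot x₁ y₁ * dot x₂ y₂ * dot x₃ y₃) := by
  have : ∀ a b c, (g a * g b * g c) • F a b c =
      L ((g a • (x₁ a * y₁ a)) * (g b • (x₂ b * y₂ b)) * (g c • (x₃ c * y₃ c))) := by
    intro a b c
    rw [H, ← map_smul]
    simp only [Algebra.smul_def, map_mul]
    congr 1
    ring
  simp only [contr3, this, ← map_sum, ← Finset.mul_sum, ← Finset.sum_mul, dot]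

theorem contr4_eq {F : Fin 4 → Fin 4 → Fin 4 → Fin 4 → R} (x₁ y₁ x₂ y₂ x₃ y₃ x₄ y₄ : Fin 4 → R)
    (H : ∀ a b c e, F a b c e =
      x₁ a * y₁ a * (x₂ b * y₂ b) * (x₃ c * y₃ c) * (x₄ e * y₄ e)) :
    contr4 F = dot x₁ y₁ * dot x₂ y₂ * dot x₃ y₃ * dot x₄ y₄ := by
  have : ∀ a b c e, (g a * g b * g c * g e) • F a b c e =
      (g a • (x₁ a * y₁ a)) * (g b • (x₂ b * y₂ b)) * (g c • (x₃ c * y₃ c)) *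
        (g e • (x₄ e * y₄ e)) := by
    intro a b c e
    rw [H]
    simp only [Algebra.smul_def, map_mul]
    ring
  simp only [contr4, this, ← Finset.mul_sum, ← Finset.sum_mul, dot]

theorem contr4_add (F G : Fin 4 → Fin 4 → Fin 4 → Fin 4 → V) :
    contr4 (fun a b c e => F a b c e + G a b c e) = contr4 F + contr4 G := by
  simp only [contr4, smul_add, Finset.sum_add_distrib]

theorem contr4_map (L : V →ₗ[ℂ] W) (F : Fin 4 → Fin 4 → Fin 4 → Fin 4 → V) :
    contr4 (fun a b c e => L (F a b c e)) = L (contr4 F) := by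
  simp only [contr4, map_sum, map_smul]

/-- The contraction which defines the part of `T` cubic in `h`, applied to a tensor with eight
indices. -/
def tForm (f : Fin 4 → Fin 4 → Fin 4 → Fin 4 → Fin 4 → Fin 4 → Fin 4 → Fin 4 → V) : V :=
  (-1 : ℂ) • contr4 (fun α β x y => f α β x x α y y β)
  + (2 : ℂ) • contr4 (fun α β μ ν => f α β μ ν α μ ν β)
  + (4 : ℂ) • contr4 (fun α β μ ν => f α β β μ ν α ν μ)
  + (2 : ℂ) • contr4 (fun α β μ x => f α β α β μ x x μ)
  + (-4 : ℂ) • contr4 (fun α β μ ν => f α β α μ ν β μ ν)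

theorem tForm_map (L : V →ₗ[ℂ] W)
    (f : Fin 4 → Fin 4 → Fin 4 → Fin 4 → Fin 4 → Fin 4 → Fin 4 → Fin 4 → V) :
    tForm (fun α β κ τ γ φ χ δ => L (f α β κ τ γ φ χ δ)) = L (tForm f) := by
  simp only [tForm, contr4_map, map_add, map_smul]

theorem tForm_add (f f' : Fin 4 → Fin 4 → Fin 4 → Fin 4 → Fin 4 → Fin 4 → Fin 4 → Fin 4 → V) :
    tForm (fun α β κ τ γ φ χ δ => f α β κ τ γ φ χ δ + f' α β κ τ γ φ χ δ) =
      tForm f + tForm f' := by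
  simp only [tForm, contr4_add, smul_add]
  abel

theorem tForm_smul (c : ℂ) (f : Fin 4 → Fin 4 → Fin 4 → Fin 4 → Fin 4 → Fin 4 → Fin 4 → Fin 4 → V) :
    tForm (fun α β κ τ γ φ χ δ => c • f α β κ τ γ φ χ δ) = c • tForm f := by
  simpa only [LinearMap.lsmul_apply] using tForm_map (LinearMap.lsmul ℂ V c) f

/-- `tForm`, evaluated on vectors in place of its eight indices. -/
def tDot (a b f i k p q l : Fin 4 → R) : R :=
  -(dot a k * dot b l * dot f i * dot p q)
  + 2 * (dot a k * dot b l * dot f p * dot i q)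
  + 4 * (dot a p * dot b f * dot i l * dot k q)
  + 2 * (dot a f * dot b i * dot k l * dot p q)
  - 4 * (dot a f * dot b p * dot i q * dot k l)

theorem tForm_dot (a b f i k p q l : Fin 4 → R) :
    tForm (fun α β κ τ γ φ χ δ => a α * b β * (f κ * i τ * k γ) * (p φ * q χ * l δ)) =
      tDot a b f i k p q l := by
  simp only [tForm]
  rw [contr4_eq a k b l f i p q (by intros; ring), contr4_eq a k b l f p i q (by intros; ring),
    contr4_eq a p b f i l k q (by intros; ring), contr4_eq a f b i k l p q (by intros; ring),
    contr4_eq a f b p i q k l (by intros; ring)]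
  simp only [tDot, Algebra.smul_def, map_neg, map_ofNat, map_one]
  ring

/-- Twice the symbol of the Euler derivative of `tForm`. -/
def eulerDot (a b p₁ k₁ p₂ k₂ : Fin 4 → R) : R :=
  tDot a b p₁ p₁ k₁ p₂ p₂ k₂ + tDot b a p₁ p₁ k₁ p₂ p₂ k₂
  - (tDot p₁ p₁ a b (k₁ + k₂) p₂ p₂ k₂ + tDot p₁ p₁ b a (k₁ + k₂) p₂ p₂ k₂)
  - (tDot p₁ p₁ p₂ p₂ k₂ a b (k₁ + k₂) + tDot p₁ p₁ p₂ p₂ k₂ b a (k₁ + k₂))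

/-- The polynomial identity behind `𝒟_{μν} + η_{μν} 𝒟`: it is symmetrized because the fields
commute, and the `2` compensates the normalization of `eulerDot`. -/
theorem eulerDot_sum (a b p₁ k₁ p₂ k₂ : Fin 4 → R) (h₁ : dot k₁ k₁ = 0) (h₂ : dot k₂ k₂ = 0) :
    eulerDot a b p₁ k₁ p₂ k₂ + eulerDot a b p₂ k₂ p₁ k₁ =
      2 * (calDDDot a b p₁ k₁ p₂ k₂ + calDDDot a b p₂ k₂ p₁ k₁
        + dot a b * (calDDot p₁ k₁ p₂ k₂ + calDDot p₂ k₂ p₁ k₁)) := by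
  simp only [eulerDot, tDot, calDDot, calDDDot, add_dot, dot_add, h₁, h₂, dot_comm b a,
    dot_comm p₁ a, dot_comm p₂ a, dot_comm k₁ a, dot_comm k₂ a, dot_comm p₁ b, dot_comm p₂ b,
    dot_comm k₁ b, dot_comm k₂ b, dot_comm p₂ p₁, dot_comm k₁ p₁, dot_comm k₁ p₂, dot_comm k₂ p₁,
    dot_comm k₂ p₂, dot_comm k₂ k₁]
  ring

end Contraction

/-! ### The Euler derivative in terms of bilinear symbols -/

section
open Symb2

/-- The symbols all of whose multiples vanish on shell. -/
def nullSymbolsHH : Ideal Symb2 where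
  carrier := {x | ∀ y, quantHH 2 (x * y) ∈ eomSubmodule}
  zero_mem' := by intro y; rw [zero_mul, map_zero]; exact Submodule.zero_mem _
  add_mem' := by
    intro a b ha hb y
    rw [add_mul, map_add]
    exact Submodule.add_mem _ (ha y) (hb y)
  smul_mem' := by
    intro c a ha y
    rw [smul_eq_mul, mul_comm c, mul_assoc]
    exact ha _

theorem quantHH_mem_eom {x : Symb2} (hx : x ∈ nullSymbolsHH) : quantHH 2 x ∈ eomSubmodule := by
  simpa using hx 1

theorem h_mul_h (α β κ τ : Fin 4) (s t : Multiset (Fin 4)) :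
    h α β s * h κ τ t = quantHH (s.card + t.card) (mon (({α, β}, s), ({κ, τ}, t))) := by
  rw [quantHH_mon, if_pos rfl, slotH_pair, slotH_pair]

theorem h1_mul_h1 (α β γ κ τ δ : Fin 4) : h α β {γ} * h κ τ {δ} =
    quantHH 2 (pol₁ α * pol₁ β * mom₁ γ * (pol₂ κ * pol₂ τ * mom₂ δ)) := by
  rw [h_mul_h]
  simp [pol₁, pol₂, mom₁, mom₂, mon_mul_mon, Multiset.insert_eq_cons]

theorem h0_mul_h2 (α β κ τ γ δ : Fin 4) : h α β 0 * h κ τ {γ, δ} =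
    quantHH 2 (pol₁ α * pol₁ β * (pol₂ κ * pol₂ τ * mom₂ γ * mom₂ δ)) := by
  rw [h_mul_h]
  simp [pol₁, pol₂, mom₂, mon_mul_mon, Multiset.insert_eq_cons]

theorem h0_mul_h1 (α β κ τ γ : Fin 4) : h α β 0 * h κ τ {γ} =
    quantHH 1 (pol₁ α * pol₁ β * (pol₂ κ * pol₂ τ * mom₂ γ)) := by
  rw [h_mul_h]
  simp [pol₁, pol₂, mom₂, mon_mul_mon, Multiset.insert_eq_cons]

/-- The Euler derivative with respect to `h`. -/
def eulerH (μ ν : Fin 4) : Jet →ₗ[ℂ] Jet :=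
  wickH μ ν 0 - ∑ lam, g lam • (d lam).comp (wickH μ ν {lam})

theorem eulerH_apply (μ ν : Fin 4) (A : Jet) :
    eulerH μ ν A = wickH μ ν 0 A - ∑ lam, g lam • d lam (wickH μ ν {lam} A) := by
  simp [eulerH]

theorem wickH_zero_hhh (μ ν α β κ τ γ φ χ δ : Fin 4) :
    wickH μ ν 0 (h α β 0 * h κ τ {γ} * h φ χ {δ}) = symη μ ν α β • (h κ τ {γ} * h φ χ {δ}) := by
  simp only [wickH_mul, wickH_h, Multiset.singleton_ne_zero, if_true, if_false, map_zero, mul_zero,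
    zero_mul, add_zero, Multiset.map_zero, Multiset.prod_zero, one_mul, Algebra.smul_def, mul_assoc]

theorem wickH_single_hhh (μ ν l α β κ τ γ φ χ δ : Fin 4) :
    wickH μ ν {l} (h α β 0 * h κ τ {γ} * h φ χ {δ}) =
      (if γ = l then g l * symη μ ν κ τ else 0) • (h α β 0 * h φ χ {δ})
      + (if δ = l then g l * symη μ ν φ χ else 0) • (h α β 0 * h κ τ {γ}) := by
  have h0 : (0 : Multiset (Fin 4)) ≠ {l} := (Multiset.singleton_ne_zero l).symm
  simp only [wickH_mul, wickH_h, if_neg h0, map_zero, zero_mul, zero_add, Multiset.map_singleton,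
    Multiset.prod_singleton, Multiset.singleton_inj]
  simp only [← Algebra.commutes, ← Algebra.smul_def, smul_mul_assoc]

theorem eulerH_hhh (μ ν α β κ τ γ φ χ δ : Fin 4) :
    eulerH μ ν (h α β 0 * h κ τ {γ} * h φ χ {δ}) =
      symη μ ν α β • (h κ τ {γ} * h φ χ {δ}) - (symη μ ν κ τ • d γ (h α β 0 * h φ χ {δ})
        + symη μ ν φ χ • d δ (h α β 0 * h κ τ {γ})) := by
  -- The metric sign in the normalization of the Wick product cancels the one of the contraction,
  -- leaving the plain derivative.
  have key : ∀ (γ : Fin 4) (c : ℂ) (A : Jet),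
      ∑ l, g l • (if γ = l then g l * c else 0) • d l A = c • d γ A := by
    intro γ c A
    rw [Finset.sum_eq_single γ]
    · rw [if_pos rfl, smul_smul, ← mul_assoc, g_mul_self, one_mul]
    · intro l _ hl
      rw [if_neg (Ne.symm hl), zero_smul, smul_zero]
    · simp
  rw [eulerH_apply, wickH_zero_hhh]
  simp only [wickH_single_hhh, map_add, map_smul, smul_add, Finset.sum_add_distrib, key]

/-- Expresses the normalization through coordinate vectors, so that the Euler derivative is again a
contraction of product tensors. -/
theorem symη_mul (μ ν α β : Fin 4) (A : Symb2) : symη μ ν α β • A = (1 / 2 : ℂ) •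
    (basisVec μ α * basisVec ν β * A + basisVec ν α * basisVec μ β * A) := by
  simp only [symη, basisVec, ← map_mul, ← Algebra.smul_def, ← add_smul, smul_smul]
  congr 1
  ring

/-- The part of `T` cubic in `h`. -/
def Thhh : Jet := tForm fun α β κ τ γ φ χ δ => h α β 0 * h κ τ {γ} * h φ χ {δ}

/-- Each field is removed in turn. For a differentiated one the derivative is integrated by parts
and acts on the other two, which gives the momentum `-(k₁ + k₂)`. -/
theorem eulerH_Thhh (μ ν : Fin 4) : eulerH μ ν Thhh =
    (1 / 2 : ℂ) • quantHH 2 (eulerDot (basisVec μ) (basisVec ν) pol₁ mom₁ pol₂ mom₂) := by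
  have e₁ : ∀ α β κ τ γ φ χ δ : Fin 4, eulerH μ ν (h α β 0 * h κ τ {γ} * h φ χ {δ}) =
      quantHH 2 ((1 / 2 : ℂ) • (
        basisVec μ α * basisVec ν β * (pol₁ κ * pol₁ τ * mom₁ γ) * (pol₂ φ * pol₂ χ * mom₂ δ)
        + basisVec ν α * basisVec μ β * (pol₁ κ * pol₁ τ * mom₁ γ) * (pol₂ φ * pol₂ χ * mom₂ δ)
        + (-1 : ℂ) • (pol₁ α * pol₁ β * (basisVec μ κ * basisVec ν τ * (mom₁ + mom₂) γ)
            * (pol₂ φ * pol₂ χ * mom₂ δ))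
        + (-1 : ℂ) • (pol₁ α * pol₁ β * (basisVec ν κ * basisVec μ τ * (mom₁ + mom₂) γ)
            * (pol₂ φ * pol₂ χ * mom₂ δ))
        + (-1 : ℂ) • (pol₁ α * pol₁ β * (pol₂ κ * pol₂ τ * mom₂ γ)
            * (basisVec μ φ * basisVec ν χ * (mom₁ + mom₂) δ))
        + (-1 : ℂ) • (pol₁ α * pol₁ β * (pol₂ κ * pol₂ τ * mom₂ γ)
            * (basisVec ν φ * basisVec μ χ * (mom₁ + mom₂) δ)))) := by
    intro α β κ τ γ φ χ δ
    rw [eulerH_hhh, h1_mul_h1, h0_mul_h1, h0_mul_h1, d_quantHH, d_quantHH, one_add_one_eq_two, ← map_smul, ← map_smul,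
      ← map_smul, ← map_add, ← map_sub, symη_mul, symη_mul, symη_mul, ← smul_add, ← smul_sub]
    refine congrArg (fun x => quantHH 2 ((1 / 2 : ℂ) • x)) ?_
    simp only [neg_one_smul, Pi.add_apply]
    ring
  rw [Thhh, ← tForm_map]
  simp only [e₁]
  rw [tForm_map, tForm_smul, map_smul]
  simp only [tForm_add, tForm_smul, tForm_dot]
  refine congrArg (fun x => (1 / 2 : ℂ) • quantHH 2 x) ?_
  simp only [eulerDot, neg_one_smul]
  ring

theorem calD_eq : calD = quantHH 2 (calDDot pol₁ mom₁ pol₂ mom₂) := by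
  have e : calD = (2 : ℂ) • (contr3 (fun ρ σ x => h ρ σ {σ} * h x x {ρ})
      + contr3 (fun ρ σ x => h ρ σ 0 * h x x {ρ, σ})
      - contr3 (fun ρ σ l => h ρ σ {l} * h ρ σ {l})) := by
    simp only [calD, contr3, trh, Finset.mul_sum, mul_smul_comm, Finset.smul_sum, smul_smul]
  rw [e, contr3_map_eq (quantHH 2) pol₁ mom₂ pol₁ mom₁ pol₂ pol₂ (by intros; rw [h1_mul_h1]; exact congrArg (quantHH 2) (by ring)),
    contr3_map_eq (quantHH 2) pol₁ mom₂ pol₁ mom₂ pol₂ pol₂ (by intros; rw [h0_mul_h2]; exact congrArg (quantHH 2) (by ring)),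
    contr3_map_eq (quantHH 2) pol₁ pol₂ pol₁ pol₂ mom₁ mom₂ (by intros; rw [h1_mul_h1]; exact congrArg (quantHH 2) (by ring)),
    ← map_add, ← map_sub, ← map_smul]
  refine congrArg (quantHH 2) ?_
  simp only [calDDot, Algebra.smul_def, map_ofNat]
  ring

theorem calDD_eq (μ ν : Fin 4) : calDD μ ν =
    quantHH 2 (calDDDot (basisVec μ) (basisVec ν) pol₁ mom₁ pol₂ mom₂) := by
  have e : calDD μ ν = -contr2 (fun x y => h x x {μ} * h y y {ν})
      + (2 : ℂ) • contr2 (fun ρ σ => h ρ σ {μ} * h ρ σ {ν})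
      + (4 : ℂ) • (contr2 (fun ρ σ => h μ ρ {σ} * h ν σ {ρ})
        + contr2 (fun ρ σ => h μ ρ {σ} * h ν ρ {σ}))
      - (4 : ℂ) • (contr2 (fun ρ σ => h ρ σ {ρ} * h μ ν {σ})
        + contr2 (fun ρ σ => h ρ σ 0 * h μ ν {ρ, σ}))
      - (4 : ℂ) • (contr2 (fun ρ σ => h μ ρ {σ} * h ρ σ {ν})
        + contr2 (fun ρ σ => h ν ρ {σ} * h ρ σ {μ})
        + contr2 (fun ρ σ => h μ ρ 0 * h ρ σ {ν, σ})
        + contr2 (fun ρ σ => h ν ρ 0 * h ρ σ {μ, σ})) := by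
    simp only [calDD, contr2, trh, Finset.sum_mul_sum, smul_mul_smul_comm, smul_add,
      Finset.sum_add_distrib]
  rw [e,
    contr2_map_eq (quantHH 2) (mom₁ μ * mom₂ ν) pol₁ pol₁ pol₂ pol₂ (by intros; rw [h1_mul_h1]; exact congrArg (quantHH 2) (by ring)),
    contr2_map_eq (quantHH 2) (mom₁ μ * mom₂ ν) pol₁ pol₂ pol₁ pol₂ (by intros; rw [h1_mul_h1]; exact congrArg (quantHH 2) (by ring)),
    contr2_map_eq (quantHH 2) (pol₁ μ * pol₂ ν) pol₁ mom₂ pol₂ mom₁ (by intros; rw [h1_mul_h1]; exact congrArg (quantHH 2) (by ring)),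
    contr2_map_eq (quantHH 2) (pol₁ μ * pol₂ ν) pol₁ pol₂ mom₁ mom₂ (by intros; rw [h1_mul_h1]; exact congrArg (quantHH 2) (by ring)),
    contr2_map_eq (quantHH 2) (pol₂ μ * pol₂ ν) pol₁ mom₁ pol₁ mom₂ (by intros; rw [h1_mul_h1]; exact congrArg (quantHH 2) (by ring)),
    contr2_map_eq (quantHH 2) (pol₂ μ * pol₂ ν) pol₁ mom₂ pol₁ mom₂ (by intros; rw [h0_mul_h2]; exact congrArg (quantHH 2) (by ring)),
    contr2_map_eq (quantHH 2) (pol₁ μ * mom₂ ν) pol₁ pol₂ pol₂ mom₁ (by intros; rw [h1_mul_h1]; exact congrArg (quantHH 2) (by ring)),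
    contr2_map_eq (quantHH 2) (pol₁ ν * mom₂ μ) pol₁ pol₂ pol₂ mom₁ (by intros; rw [h1_mul_h1]; exact congrArg (quantHH 2) (by ring)),
    contr2_map_eq (quantHH 2) (pol₁ μ * mom₂ ν) pol₁ pol₂ pol₂ mom₂ (by intros; rw [h0_mul_h2]; exact congrArg (quantHH 2) (by ring)),
    contr2_map_eq (quantHH 2) (pol₁ ν * mom₂ μ) pol₁ pol₂ pol₂ mom₂ (by intros; rw [h0_mul_h2]; exact congrArg (quantHH 2) (by ring))]
  simp only [← map_add, ← map_sub, ← map_smul, ← map_neg]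
  refine congrArg (quantHH 2) ?_
  simp only [calDDDot, dot_basisVec, Algebra.smul_def, map_ofNat]
  ring

theorem swap_basisVec (μ α : Fin 4) : swap (basisVec μ α) = basisVec μ α := AlgHom.commutes _ _

/-- Bose symmetry allows replacing the symbol of the difference by its symmetrization, and that
vanishes once both momenta are massless. -/
theorem eulerH_Thhh_onShell (μ ν : Fin 4) :
    eulerH μ ν Thhh - (calDD μ ν + η μ ν • calD) ∈ eomSubmodule := by
  set a : Fin 4 → Symb2 := basisVec μ with ha
  set b : Fin 4 → Symb2 := basisVec ν with hb
  set X : Symb2 := eulerDot a b pol₁ mom₁ pol₂ mom₂ - 2 * (calDDDot a b pol₁ mom₁ pol₂ mom₂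
    + dot a b * calDDot pol₁ mom₁ pol₂ mom₂) with hX
  have hsw : swap X = eulerDot a b pol₂ mom₂ pol₁ mom₁ - 2 * (calDDDot a b pol₂ mom₂ pol₁ mom₁
      + dot a b * calDDot pol₂ mom₂ pol₁ mom₁) := by
    have hadd : ∀ α, swap ((mom₁ + mom₂) α) = (mom₂ + mom₁) α := fun α => by
      simp only [Pi.add_apply, map_add, swap_mom₁, swap_mom₂]
    simp only [hX, ha, hb, eulerDot, tDot, calDDDot, calDDot, map_sub, map_add, map_neg, map_mul,
      map_ofNat, map_dot, hadd, swap_pol₁, swap_pol₂, swap_mom₁, swap_mom₂, swap_basisVec]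
  have hnull : X + swap X ∈ nullSymbolsHH := by
    rw [← Ideal.Quotient.eq_zero_iff_mem]
    -- In the quotient the squares of the momenta are literally zero, so the identity over
    -- commutative rings applies.
    let π : Symb2 →ₐ[ℂ] Symb2 ⧸ nullSymbolsHH := Ideal.Quotient.mkₐ ℂ nullSymbolsHH
    have h₁ : dot (fun α => π (mom₁ α)) (fun α => π (mom₁ α)) = 0 := by
      rw [← map_dot]
      exact Ideal.Quotient.eq_zero_iff_mem.2 (quantHH_box₁ 2)
    have h₂ : dot (fun α => π (mom₂ α)) (fun α => π (mom₂ α)) = 0 := by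
      rw [← map_dot]
      exact Ideal.Quotient.eq_zero_iff_mem.2 (quantHH_box₂ 2)
    have key := eulerDot_sum (fun α => π (a α)) (fun α => π (b α)) (fun α => π (pol₁ α))
      (fun α => π (mom₁ α)) (fun α => π (pol₂ α)) (fun α => π (mom₂ α)) h₁ h₂
    change π (X + swap X) = 0
    have hadd : (fun α => π ((mom₁ + mom₂) α)) = (fun α => π (mom₁ α)) + fun α => π (mom₂ α) := by
      funext α; simp
    have hadd' : (fun α => π ((mom₂ + mom₁) α)) = (fun α => π (mom₂ α)) + fun α => π (mom₁ α) := by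
      funext α; simp
    rw [hsw, hX]
    simp only [eulerDot, tDot, calDDDot, calDDot, map_sub, map_add, map_neg, map_mul, map_ofNat,
      map_dot, hadd, hadd'] at key ⊢
    linear_combination key
  have h2 := quantHH_mem_eom hnull
  rw [map_add, quantHH_swap] at h2
  -- One factor `1/2` comes from the Wick normalization, the other from averaging over the exchange.
  have h3 : eulerH μ ν Thhh - (calDD μ ν + η μ ν • calD) =
      (1 / 4 : ℂ) • (quantHH 2 X + quantHH 2 X) := by
    have hη : dot a b = algebraMap ℂ Symb2 (η μ ν) := by rw [ha, hb, basisVec_dot, basisVec, η_comm]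
    have h2' : (2 : Symb2) = algebraMap ℂ Symb2 2 := by rw [map_ofNat]
    rw [eulerH_Thhh, calDD_eq, calD_eq, hX, hη, h2', ← Algebra.smul_def, ← Algebra.smul_def, map_sub,
      map_smul, map_add, map_smul]
    module
  rw [h3]
  exact Submodule.smul_mem _ _ h2

end

/-! ### The anomaly in terms of the Euler derivative -/

section Contraction
variable {V W : Type} [AddCommGroup V] [Module ℂ V] [AddCommGroup W] [Module ℂ W]
variable {R : Type} [CommRing R] [Algebra ℂ R]

theorem contr3_map (L : V →ₗ[ℂ] W) (F : Fin 4 → Fin 4 → Fin 4 → V) :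
    contr3 (fun a b c => L (F a b c)) = L (contr3 F) := by
  simp only [contr3, map_sum, map_smul]

theorem contr3_sub (F G : Fin 4 → Fin 4 → Fin 4 → V) :
    contr3 (fun a b c => F a b c - G a b c) = contr3 F - contr3 G := by
  simp only [contr3, smul_sub, Finset.sum_sub_distrib]

theorem contr3_mem {S : Submodule ℂ V} {F : Fin 4 → Fin 4 → Fin 4 → V} (H : ∀ a b c, F a b c ∈ S) :
    contr3 F ∈ S :=
  S.sum_mem fun _ _ => S.sum_mem fun _ _ => S.sum_mem fun _ _ => S.smul_mem _ (H _ _ _)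

theorem contr3_reverse (F : Fin 4 → Fin 4 → Fin 4 → V) :
    contr3 (fun a b c => F c b a) = contr3 F := by
  simp only [contr3]
  rw [Finset.sum_comm]
  refine (Finset.sum_congr rfl fun b _ => Finset.sum_comm).trans ?_
  rw [Finset.sum_comm]
  refine Finset.sum_congr rfl fun a _ => Finset.sum_congr rfl fun b _ =>
    Finset.sum_congr rfl fun c _ => ?_
  congr 1
  ring

theorem contr2_add (F G : Fin 4 → Fin 4 → V) :
    contr2 (fun a b => F a b + G a b) = contr2 F + contr2 G := by
  simp only [contr2, smul_add, Finset.sum_add_distrib]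

theorem contr3_mul_first (s t : Fin 4 → R) (F : Fin 4 → Fin 4 → R) :
    contr3 (fun a b c => s a * t a * F b c) = dot s t * contr2 F := by
  have : ∀ a b c, (g a * g b * g c) • (s a * t a * F b c) =
      (g a • (s a * t a)) * ((g b * g c) • F b c) := by
    intro a b c
    rw [smul_mul_smul_comm, mul_assoc (g a)]
  simp only [contr3, this, ← Finset.mul_sum, ← Finset.sum_mul, contr2, dot]

theorem contr3_mul_second (s t : Fin 4 → R) (F : Fin 4 → Fin 4 → R) :
    contr3 (fun a b c => s b * t b * F a c) = dot s t * contr2 F := by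
  rw [← contr3_mul_first]
  simp only [contr3]
  rw [Finset.sum_comm]
  simp only [mul_comm (g _) (g _)]

theorem contr2_dot (r : R) (x₁ y₁ x₂ y₂ : Fin 4 → R) :
    contr2 (fun a b => r * (x₁ a * y₁ a) * (x₂ b * y₂ b)) = r * dot x₁ y₁ * dot x₂ y₂ := by
  rw [contr2_map_eq (LinearMap.id : R →ₗ[ℂ] R) r x₁ y₁ x₂ y₂ fun _ _ => (LinearMap.id_apply _).symm,
    LinearMap.id_apply]

theorem contr2_η (r : R) (a b : Fin 4 → R) :
    contr2 (fun μ ν => r * (a μ * b ν * algebraMap ℂ R (η μ ν))) = r * dot a b := by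
  have : ∀ μ, ∑ ν, (g μ * g ν) • (r * (a μ * b ν * algebraMap ℂ R (η μ ν))) =
      r * (g μ • (a μ * b μ)) := by
    intro μ
    rw [← basisVec_dot μ b, dot]
    simp only [Finset.mul_sum, Finset.smul_sum]
    refine Finset.sum_congr rfl fun ν _ => ?_
    rw [basisVec]
    simp only [Algebra.smul_def, map_mul]
    ring
  simp only [contr2, this, ← Finset.mul_sum, dot]

/-- `calDDDot` is bilinear in its first two vectors, so contracting its components puts `a`, `b` in
their place, while the metric term yields `dot a b`. -/
theorem contr2_calD (a b p₂ k₂ p₃ k₃ : Fin 4 → R) :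
    contr2 (fun μ ν => a μ * b ν * (calDDDot (basisVec μ) (basisVec ν) p₂ k₂ p₃ k₃
      + algebraMap ℂ R (η μ ν) * calDDot p₂ k₂ p₃ k₃)) =
    dot a b * calDDot p₂ k₂ p₃ k₃ + calDDDot a b p₂ k₂ p₃ k₃ := by
  have e : ∀ μ ν, a μ * b ν * (calDDDot (basisVec μ) (basisVec ν) p₂ k₂ p₃ k₃
      + algebraMap ℂ R (η μ ν) * calDDot p₂ k₂ p₃ k₃) =
      (-(dot p₂ p₂ * dot p₃ p₃) + 2 * (dot p₂ p₃ * dot p₂ p₃)) * (k₂ μ * a μ) * (k₃ ν * b ν)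
      + 4 * (dot p₂ k₃ * dot p₃ k₂ + dot p₂ p₃ * dot k₂ k₃) * (p₂ μ * a μ) * (p₃ ν * b ν)
      + -4 * (dot p₂ k₂ * dot p₂ k₃ + dot p₂ k₃ * dot p₂ k₃) * (p₃ μ * a μ) * (p₃ ν * b ν)
      + -4 * (dot p₂ p₃ * dot p₃ k₂ + dot p₂ p₃ * dot p₃ k₃) * (p₂ μ * a μ) * (k₃ ν * b ν)
      + -4 * (dot p₂ p₃ * dot p₃ k₂ + dot p₂ p₃ * dot p₃ k₃) * (k₃ μ * a μ) * (p₂ ν * b ν)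
      + calDDot p₂ k₂ p₃ k₃ * (a μ * b ν * algebraMap ℂ R (η μ ν)) := by
    intro μ ν
    simp only [calDDDot, dot_basisVec]
    ring
  simp only [e, contr2_add, contr2_dot, contr2_η]
  rw [calDDDot]
  ring

end Contraction

/-- The contraction of `u h` with a symmetric tensor which occurs in the anomaly. -/
def ghostContraction (X : Fin 4 → Fin 4 → Jet) : Jet :=
  (4 : ℂ) • contr3 (fun ρ μ ν => u ρ 0 * h μ ν {ρ} * X μ ν)
  + (4 : ℂ) • contr3 (fun ρ μ ν => u ρ {ρ} * h μ ν 0 * X μ ν)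
  + (-8 : ℂ) • contr3 (fun μ ν l => u μ {ν} * h ν l 0 * X μ l)

theorem ghostContraction_sub_mem {X Y : Fin 4 → Fin 4 → Jet}
    (H : ∀ μ ν, X μ ν - Y μ ν ∈ eomSubmodule) :
    ghostContraction X - ghostContraction Y ∈ eomSubmodule := by
  have e : ghostContraction X - ghostContraction Y =
      ghostContraction (fun μ ν => X μ ν - Y μ ν) := by
    simp only [ghostContraction, mul_sub, contr3_sub, smul_sub]
    abel
  rw [e]
  refine Submodule.add_mem _ (Submodule.add_mem _ ?_ ?_) ?_
  all_goals
    exact Submodule.smul_mem _ _ (contr3_mem fun _ _ _ => eom.mul_mem_left _ _ (H _ _))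

theorem sum_η_smul (μ : Fin 4) (f : Fin 4 → Jet) : ∑ ν, (g ν * η μ ν) • f ν = f μ := by
  rw [Finset.sum_eq_single μ]
  · rw [η, if_pos rfl, g_mul_self, one_smul]
  · intro ν _ hν
    rw [η, if_neg (Ne.symm hν), mul_zero, zero_smul]
  · simp

/-- In `𝒜_ρ`, `𝒜` and `𝒜_{μν}` the term with `𝒟` is the metric part of a contraction with `𝒟_{μν} +
η_{μν} 𝒟`, so one symmetric tensor accounts for all three. -/
theorem anomalyForm_eq :
    (∑ ρ, g ρ • (u ρ 0 * calA1 ρ)) + (∑ ρ, g ρ • (u ρ {ρ} * calA0))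
      + ∑ μ, ∑ ν, (g μ * g ν) • (u μ {ν} * calA2 μ ν) =
    ghostContraction (fun μ ν => calDD μ ν + η μ ν • calD) := by
  have tr : ∀ s : Multiset (Fin 4), ∑ μ, ∑ ν, (g μ * g ν) • (h μ ν s * (calDD μ ν + η μ ν • calD)) =
      trh s * calD + ∑ μ, ∑ ν, (g μ * g ν) • (h μ ν s * calDD μ ν) := by
    intro s
    simp only [mul_add, smul_add, Finset.sum_add_distrib, mul_smul_comm, smul_smul]
    rw [add_comm]
    refine congrArg (· + _) ?_
    rw [trh, Finset.sum_mul]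
    refine Finset.sum_congr rfl fun μ _ => ?_
    simp only [mul_assoc, ← smul_smul (g μ), ← Finset.smul_sum]
    rw [sum_η_smul μ fun ν => h μ ν s * calD, smul_mul_assoc]
  have e₁ : ∀ ρ, calA1 ρ = (4 : ℂ) •
      ∑ μ, ∑ ν, (g μ * g ν) • (h μ ν {ρ} * (calDD μ ν + η μ ν • calD)) := by
    intro ρ
    rw [tr, calA1, smul_add]
  have e₀ : calA0 = (4 : ℂ) •
      ∑ μ, ∑ ν, (g μ * g ν) • (h μ ν 0 * (calDD μ ν + η μ ν • calD)) := by
    rw [tr, calA0, smul_add]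
  have e₂ : ∀ μ ν, calA2 μ ν = (-8 : ℂ) •
      ∑ l, g l • (h ν l 0 * (calDD μ l + η μ l • calD)) := by
    intro μ ν
    simp only [mul_add, smul_add, Finset.sum_add_distrib, mul_smul_comm, smul_smul]
    rw [sum_η_smul μ fun l => h ν l 0 * calD, calA2, h_symm μ ν, add_comm]
  simp only [e₁, e₀, e₂, ghostContraction, contr3, mul_smul_comm, Finset.mul_sum, Finset.smul_sum,
    smul_smul, ← mul_assoc]
  refine congrArg₂ (· + ·) (congrArg₂ (· + ·) ?_ ?_) ?_
  all_goals
    refine Finset.sum_congr rfl fun a _ => Finset.sum_congr rfl fun b _ =>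
      Finset.sum_congr rfl fun c _ => ?_
    exact congrArg (· • _) (by ring)

/-! ### The symbol of the contracted anomaly -/

section
open Symb4

theorem ghostContraction_calD : ghostContraction (fun μ ν => calDD μ ν + η μ ν • calD) =
    quantU 3 (anomalyDot pol₀ mom₀ pol₁ mom₁ pol₂ mom₂ pol₃ mom₃) := by
  set x : Fin 4 → Fin 4 → Symb4 := fun μ ν => calDDDot (basisVec μ) (basisVec ν) pol₂ mom₂ pol₃ mom₃
    + algebraMap ℂ Symb4 (η μ ν) * calDDot pol₂ mom₂ pol₃ mom₃ with hx
  have e : ∀ μ ν (ρ α β : Fin 4) (s t : Multiset (Fin 4)), s.card + t.card = 1 →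
      u ρ s * h α β t * (calDD μ ν + η μ ν • calD) =
        quantU 3 (mon ((({ρ}, s), ({α, β}, t)), 0) * x μ ν) := by
    intro μ ν ρ α β s t hst
    have hbv : ∀ μ α, Symb2.toSymb4 (basisVec μ α) = basisVec μ α := fun μ α => AlgHom.commutes _ _
    rw [calDD_eq, calD_eq, ← map_smul, ← map_add, u_mul_h_mul_quantHH, hst, Algebra.smul_def]
    simp only [hx, calDDDot, calDDot, map_sub, map_add, map_neg, map_mul, map_ofNat, map_dot, hbv,
      Symb2.toSymb4_pol₁, Symb2.toSymb4_pol₂, Symb2.toSymb4_mom₁, Symb2.toSymb4_mom₂,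
      AlgHom.commutes]
  have m₁ : ∀ ρ μ ν : Fin 4, (mon ((({ρ}, 0), ({μ, ν}, {ρ})), 0) : Symb4) =
      pol₀ ρ * mom₁ ρ * (pol₁ μ * pol₁ ν) := by
    intros
    simp [pol₀, mom₁, pol₁, mon_mul_mon, Multiset.insert_eq_cons]
  have m₂ : ∀ ρ σ μ ν : Fin 4, (mon ((({ρ}, {σ}), ({μ, ν}, 0)), 0) : Symb4) =
      pol₀ ρ * mom₀ σ * (pol₁ μ * pol₁ ν) := by
    intros
    simp [pol₀, mom₀, pol₁, mon_mul_mon, Multiset.insert_eq_cons]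
  have c₁ : contr3 (fun ρ μ ν => u ρ 0 * h μ ν {ρ} * (calDD μ ν + η μ ν • calD)) =
      quantU 3 (dot pol₀ mom₁ * (dot pol₁ pol₁ * calDDot pol₂ mom₂ pol₃ mom₃
        + calDDDot pol₁ pol₁ pol₂ mom₂ pol₃ mom₃)) := by
    rw [← contr2_calD, ← contr3_mul_first, ← contr3_map]
    simp only [e _ _ _ _ _ 0 {_} (by simp), m₁, mul_assoc, hx]
  have c₂ : contr3 (fun ρ μ ν => u ρ {ρ} * h μ ν 0 * (calDD μ ν + η μ ν • calD)) =
      quantU 3 (dot pol₀ mom₀ * (dot pol₁ pol₁ * calDDot pol₂ mom₂ pol₃ mom₃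
        + calDDDot pol₁ pol₁ pol₂ mom₂ pol₃ mom₃)) := by
    rw [← contr2_calD, ← contr3_mul_first, ← contr3_map]
    simp only [e _ _ _ _ _ {_} 0 (by simp), m₂, mul_assoc, hx]
  have c₃ : contr3 (fun μ ν l => u μ {ν} * h ν l 0 * (calDD μ l + η μ l • calD)) =
      quantU 3 (dot mom₀ pol₁ * (dot pol₀ pol₁ * calDDot pol₂ mom₂ pol₃ mom₃
        + calDDDot pol₀ pol₁ pol₂ mom₂ pol₃ mom₃)) := by
    rw [← contr2_calD, ← contr3_mul_second, ← contr3_map]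
    simp only [e _ _ _ _ _ {_} 0 (by simp), m₂, hx]
    refine congrArg contr3 (funext fun μ => funext fun ν => funext fun l =>
      congrArg (quantU 3) ?_)
    ring
  rw [ghostContraction, c₁, c₂, c₃, ← map_smul, ← map_smul, ← map_smul, ← map_add, ← map_add]
  refine congrArg (quantU 3) ?_
  simp only [anomalyDot, Algebra.smul_def, map_neg, map_ofNat]
  ring

end

/-! ### The part of the anomaly trilinear in `h` -/

/-- The ghost part of `T`. -/
def Tghost : Jet :=
  (-4 : ℂ) • contr3 (fun μ ν β => u μ 0 * ut ν {β} * h ν β {μ})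
  + (4 : ℂ) • contr3 (fun μ ν β => u β {ν} * ut β {μ} * h μ ν 0)
  + (-4 : ℂ) • contr3 (fun ν α β => u ν {ν} * ut β {α} * h α β 0)
  + (4 : ℂ) • contr3 (fun μ ν β => u μ {ν} * ut β {μ} * h ν β 0)

theorem T_eq : T = Thhh + Tghost := by
  -- The only term with two traces; each trace is expanded into one more contracted index.
  have t₁ : ∑ α, ∑ β, (-(g α * g β)) • (h α β 0 * trh {α} * trh {β}) =
      (-1 : ℂ) • contr4 (fun α β x y => h α β 0 * h x x {α} * h y y {β}) := by
    simp only [contr4, Finset.smul_sum, smul_smul]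
    refine Finset.sum_congr rfl fun α _ => Finset.sum_congr rfl fun β _ => ?_
    rw [mul_assoc, trh, trh, Finset.sum_mul_sum, Finset.mul_sum, Finset.smul_sum]
    refine Finset.sum_congr rfl fun x _ => ?_
    rw [Finset.mul_sum, Finset.smul_sum]
    refine Finset.sum_congr rfl fun y _ => ?_
    have hc : -(g α * g β) * (g x * g y) = -1 * (g α * g β * g x * g y) := by ring
    rw [smul_mul_smul_comm, mul_smul_comm, smul_smul, hc, mul_assoc (h α β 0)]
  rw [T, t₁]
  simp only [Thhh, Tghost, tForm, contr4, contr3, trh, Finset.mul_sum, mul_smul_comm, Finset.smul_sum,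
    smul_smul, mul_assoc, add_assoc]

/-- The span of the products `u ũ h`. -/
def ghostSpan : Submodule ℂ Jet := Submodule.span ℂ
  {x | ∃ a b c e r t w, x = u a r * ut b t * h c e w}

theorem Tghost_mem : Tghost ∈ ghostSpan := by
  have key : ∀ a b c e r t w, u a r * ut b t * h c e w ∈ ghostSpan := fun a b c e r t w =>
    Submodule.subset_span ⟨a, b, c, e, r, t, w, rfl⟩
  refine Submodule.add_mem _ (Submodule.add_mem _ (Submodule.add_mem _ ?_ ?_) ?_) ?_
  all_goals exact Submodule.smul_mem _ _ (contr3_mem fun _ _ _ => key _ _ _ _ _ _ _)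

theorem linearMap_ghost_mem {L : Jet →ₗ[ℂ] Jet} {S : Submodule ℂ Jet}
    (H : ∀ a b c e r t w, L (u a r * ut b t * h c e w) ∈ S) : L Tghost ∈ S := by
  have : ghostSpan ≤ S.comap L := by
    refine Submodule.span_le.2 ?_
    rintro _ ⟨a, b, c, e, r, t, w, rfl⟩
    exact H a b c e r t w
  exact this Tghost_mem

theorem linearMap_Thhh_eq_zero {L : Jet →ₗ[ℂ] Jet}
    (H : ∀ a b c e f i r t w, L (h a b r * h c e t * h f i w) = 0) : L Thhh = 0 := by
  rw [Thhh, ← tForm_map]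
  simp only [H, tForm, contr4, smul_zero, Finset.sum_const_zero, add_zero]

theorem h_mem_degH (μ ν : Fin 4) (s : Multiset (Fin 4)) : h μ ν s ∈ homog JetVar.degH 1 :=
  var_mem_homog JetVar.degH (.h s(μ, ν) s)

theorem u_mem_degH (ρ : Fin 4) (s : Multiset (Fin 4)) : u ρ s ∈ homog JetVar.degH 0 :=
  var_mem_homog JetVar.degH (.u ρ s)

theorem ut_mem_degH (ρ : Fin 4) (s : Multiset (Fin 4)) : ut ρ s ∈ homog JetVar.degH 0 :=
  var_mem_homog JetVar.degH (.ut ρ s)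

theorem B_eq (μ ν : Fin 4) : B μ ν = wickUt μ {ν} Tghost := by
  rw [B, T_eq, map_add, linearMap_Thhh_eq_zero fun _ _ _ _ _ _ _ _ _ => wickUt_hhh .., zero_add]

theorem wickU_T (μ : Fin 4) (s : Multiset (Fin 4)) : wickU μ s T = wickU μ s Tghost := by
  rw [T_eq, map_add, linearMap_Thhh_eq_zero fun _ _ _ _ _ _ _ _ _ => wickU_hhh .., zero_add]

theorem B_mem (μ ν : Fin 4) : B μ ν ∈ homog JetVar.degH 1 := by
  rw [B_eq]
  refine linearMap_ghost_mem fun a b c e r t w => ?_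
  rw [wickUt_uuth]
  exact Submodule.smul_mem _ _ (mul_mem_homog (u_mem_degH a r) (h_mem_degH c e w))

theorem eulerH_Tghost_mem (μ ν : Fin 4) : eulerH μ ν Tghost ∈ homog JetVar.degH 0 := by
  refine linearMap_ghost_mem fun a b c e r t w => ?_
  rw [eulerH_apply]
  simp only [wickH_uuth, map_smul, d_mul, d_u, d_ut]
  have hm : ∀ a b r t, u a r * ut b t ∈ homog JetVar.degH 0 := fun a b r t =>
    mul_mem_homog (u_mem_degH a r) (ut_mem_degH b t)
  exact Submodule.sub_mem _ (Submodule.smul_mem _ _ (hm _ _ _ _))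
    (Submodule.sum_mem _ fun _ _ => Submodule.smul_mem _ _ (Submodule.smul_mem _ _
      (Submodule.add_mem _ (hm _ _ _ _) (hm _ _ _ _))))

theorem eulerH_Thhh_mem (μ ν : Fin 4) : eulerH μ ν Thhh ∈ homog JetVar.degH 2 := by
  have hs : ∀ a : Slot, slotH a ∈ homog JetVar.degH 1 := fun a =>
    ((hasType_iff.1 (mem_typed.1 (slotH_mem_typed a))).1)
  rw [eulerH_Thhh]
  refine Submodule.smul_mem _ _ (linearMap_mem_of_mon ?_ _)
  rintro ⟨a, b⟩
  rw [quantHH_mon]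
  split_ifs
  · exact mul_mem_homog (hs a) (hs b)
  · exact Submodule.zero_mem _

/-- The Euler derivative with respect to `u`. -/
def eulerU (μ : Fin 4) : Jet →ₗ[ℂ] Jet :=
  wickU μ 0 - ∑ lam, g lam • (d lam).comp (wickU μ {lam})

theorem eulerU_apply (μ : Fin 4) (A : Jet) :
    eulerU μ A = wickU μ 0 A - ∑ lam, g lam • d lam (wickU μ {lam} A) := by
  simp [eulerU]

theorem eulerU_Tghost_mem (μ : Fin 4) : eulerU μ Tghost ∈ homog JetVar.degH 1 := by
  refine linearMap_ghost_mem fun a b c e r t w => ?_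
  rw [eulerU_apply]
  simp only [wickU_uuth, map_smul, d_mul, d_h, d_ut]
  have hm : ∀ a c e r t, ut a r * h c e t ∈ homog JetVar.degH 1 := fun a c e r t =>
    mul_mem_homog (ut_mem_degH a r) (h_mem_degH c e t)
  exact Submodule.sub_mem _ (Submodule.smul_mem _ _ (hm _ _ _ _ _))
    (Submodule.sum_mem _ fun _ _ => Submodule.smul_mem _ _ (Submodule.smul_mem _ _
      (Submodule.add_mem _ (hm _ _ _ _ _) (hm _ _ _ _ _))))

theorem B1_mem (μ : Fin 4) : B1 μ ∈ homog JetVar.degH 0 :=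
  Submodule.sum_mem _ fun _ _ => Submodule.smul_mem _ _
    (mul_mem_homog (u_mem_degH _ _) (u_mem_degH _ _))

/-- Degrees in `h`: `B_{μν}` has degree 1, the Euler derivatives of the cubic and ghost parts have
degrees 2 and 0, `B₁` has degree 0 and its partner degree 1. Only the product with the cubic part
reaches degree 3; all other terms have degree 1. -/
theorem anomalyUHHH_eq :
    anomalyUHHH = ∑ μ, ∑ ν, (g μ * g ν) • (wickUt μ {ν} Tghost * eulerH μ ν Thhh) := by
  have e : anomaly = (∑ μ, ∑ ν, (g μ * g ν) • (B μ ν * eulerH μ ν Thhh))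
      + ((∑ μ, ∑ ν, (g μ * g ν) • (B μ ν * eulerH μ ν Tghost))
        + ∑ μ, (2 * g μ) • (B1 μ * eulerU μ Tghost)) := by
    have e₁ : ∀ μ ν, C μ ν - ∑ lam, g lam • d lam (E μ ν lam) =
        eulerH μ ν Thhh + eulerH μ ν Tghost := by
      intro μ ν
      rw [← map_add, ← T_eq, eulerH_apply]
      rfl
    have e₂ : ∀ μ, D μ - ∑ lam, g lam • d lam (F μ lam) = eulerU μ Tghost := by
      intro μ
      simp only [D, F, wickU_T, eulerU_apply]
    simp only [anomaly, e₁, e₂, mul_add, smul_add, Finset.sum_add_distrib, add_assoc]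
  rw [anomalyUHHH, e, weightPart_add, weightPart_of_mem, weightPart_of_mem_ne (m := 1), add_zero]
  · simp only [B_eq]
  · refine Submodule.add_mem _ (Submodule.sum_mem _ fun _ _ => Submodule.sum_mem _ fun _ _ =>
      Submodule.smul_mem _ _ (mul_mem_homog (B_mem _ _) (eulerH_Tghost_mem _ _)))
      (Submodule.sum_mem _ fun _ _ => Submodule.smul_mem _ _ ?_)
    exact mul_mem_homog (B1_mem _) (eulerU_Tghost_mem _)
  · norm_num
  · exact Submodule.sum_mem _ fun _ _ => Submodule.sum_mem _ fun _ _ =>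
      Submodule.smul_mem _ _ (mul_mem_homog (B_mem _ _) (eulerH_Thhh_mem _ _))

theorem eulerH_symm (μ ν : Fin 4) (A : Jet) : eulerH μ ν A = eulerH ν μ A := by
  simp only [eulerH_apply, wickH_symm μ ν]

/-- Removing `ũ_{b,t}` from a ghost term puts the Euler tensor `X b t` in its place, with a minus
sign. By symmetry of `X` and `h` the second and fourth ghost terms coincide, which explains the
coefficient `-8`. -/
theorem anomalyUHHH_eq_ghostContraction :
    anomalyUHHH = ghostContraction fun μ ν => eulerH μ ν Thhh := by
  rw [anomalyUHHH_eq]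
  set X : Fin 4 → Fin 4 → Jet := fun μ ν => eulerH μ ν Thhh with hX
  have hs : ∀ μ ν, X μ ν = X ν μ := fun μ ν => eulerH_symm μ ν Thhh
  let L : Jet →ₗ[ℂ] Jet :=
    ∑ μ, ∑ ν, (g μ * g ν) • (LinearMap.mulRight ℂ (X μ ν)).comp (wickUt μ {ν})
  have hL : ∀ A, L A = ∑ μ, ∑ ν, (g μ * g ν) • (wickUt μ {ν} A * X μ ν) := by
    intro A
    simp [L]
  have key : ∀ (a b t c e : Fin 4) (r w : Multiset (Fin 4)),
      L (u a r * ut b {t} * h c e w) = (-1 : ℂ) • (u a r * h c e w * X b t) := by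
    intro a b t c e r w
    rw [hL, Finset.sum_eq_single b, Finset.sum_eq_single t]
    · rw [wickUt_uuth, if_pos rfl, η, if_pos rfl, smul_mul_assoc, smul_smul]
      refine congrArg (· • _) ?_
      simp only [Multiset.map_singleton, Multiset.prod_singleton]
      linear_combination (-(g b * g b)) * g_mul_self t - g_mul_self b
    · intro ν _ hν
      rw [wickUt_uuth, if_neg (by simpa using Ne.symm hν), neg_zero, zero_smul, zero_mul, smul_zero]
    · simp
    · intro μ _ hμ
      refine Finset.sum_eq_zero fun ν _ => ?_
      rw [wickUt_uuth, η, if_neg hμ, mul_zero, ite_self, neg_zero, zero_smul, zero_mul, smul_zero]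
    · simp
  rw [← hL, Tghost]
  simp only [map_add, map_smul, ← contr3_map, key]
  have hc : ∀ F : Fin 4 → Fin 4 → Fin 4 → Jet,
      contr3 (fun a b c => (-1 : ℂ) • F a b c) = (-1 : ℂ) • contr3 F := fun F => by
    simpa only [LinearMap.lsmul_apply] using contr3_map (LinearMap.lsmul ℂ Jet (-1)) F
  have r₂ : contr3 (fun μ ν β => u β {ν} * h μ ν 0 * X β μ) =
      contr3 (fun μ ν l => u μ {ν} * h ν l 0 * X μ l) := by
    rw [← contr3_reverse]
    simp only [h_symm]
  have r₃ : contr3 (fun ν α β => u ν {ν} * h α β 0 * X β α) =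
      contr3 (fun ρ μ ν => u ρ {ρ} * h μ ν 0 * X μ ν) := by
    simp only [hs]
  have r₄ : contr3 (fun μ ν β => u μ {ν} * h ν β 0 * X β μ) =
      contr3 (fun μ ν l => u μ {ν} * h ν l 0 * X μ l) := by
    simp only [hs]
  rw [hc, hc, hc, hc, r₂, r₃, r₄, ghostContraction]
  module

/-! ### The main identities -/

theorem anomalyUHHH_onShell :
    anomalyUHHH - ghostContraction (fun μ ν => calDD μ ν + η μ ν • calD) ∈ eomSubmodule := by
  rw [anomalyUHHH_eq_ghostContraction]
  exact ghostContraction_sub_mem eulerH_Thhh_onShell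

section
open Symb4

theorem map_defect {S : Type} [CommRing S] [Algebra ℂ S] (f : Symb4 →ₐ[ℂ] S)
    (v q a b c e i j : Fin 4 → Symb4) :
    f (defect v q a b c e i j) = defect (fun μ => f (v μ)) (fun μ => f (q μ)) (fun μ => f (a μ))
      (fun μ => f (b μ)) (fun μ => f (c μ)) (fun μ => f (e μ)) (fun μ => f (i μ))
      (fun μ => f (j μ)) := by
  simp only [defect, n0Var, anomalyDot, calDDot, calDDDot, n0Dot, n0Tr1, n0Tr2, n0Tr3, n0Tr4,
    map_add, map_sub, map_mul, map_neg, map_ofNat, map_dot]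

theorem sum_defect_mem_nullSymbols :
    defect pol₀ mom₀ pol₁ mom₁ pol₂ mom₂ pol₃ mom₃ + defect pol₀ mom₀ pol₁ mom₁ pol₃ mom₃ pol₂ mom₂
    + defect pol₀ mom₀ pol₂ mom₂ pol₁ mom₁ pol₃ mom₃ + defect pol₀ mom₀ pol₂ mom₂ pol₃ mom₃ pol₁ mom₁
    + defect pol₀ mom₀ pol₃ mom₃ pol₁ mom₁ pol₂ mom₂ + defect pol₀ mom₀ pol₃ mom₃ pol₂ mom₂ pol₁ mom₁
      ∈ nullSymbols := by
  -- Modulo the null symbols, masslessness of all four momenta and conservation of their sum become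
  -- equations in a commutative ring.
  rw [← Ideal.Quotient.eq_zero_iff_mem]
  let π : Symb4 →ₐ[ℂ] Symb4 ⧸ nullSymbols := Ideal.Quotient.mkₐ ℂ nullSymbols
  have hπ : ∀ {x}, x ∈ nullSymbols → π x = 0 := fun hx => Ideal.Quotient.eq_zero_iff_mem.2 hx
  have h₀ : dot (fun μ => π (mom₀ μ)) (fun μ => π (mom₀ μ)) = 0 := by
    rw [← map_dot]; exact hπ box₀_mem_nullSymbols
  have h₁ : dot (fun μ => π (mom₁ μ)) (fun μ => π (mom₁ μ)) = 0 := by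
    rw [← map_dot]; exact hπ box₁_mem_nullSymbols
  have h₂ : dot (fun μ => π (mom₂ μ)) (fun μ => π (mom₂ μ)) = 0 := by
    rw [← map_dot]; exact hπ box₂_mem_nullSymbols
  have h₃ : dot (fun μ => π (mom₃ μ)) (fun μ => π (mom₃ μ)) = 0 := by
    rw [← map_dot]; exact hπ box₃_mem_nullSymbols
  have hq : (fun μ => π (mom₀ μ)) =
      -((fun μ => π (mom₁ μ)) + (fun μ => π (mom₂ μ)) + fun μ => π (mom₃ μ)) := by
    funext μ
    have ht := hπ (total_mem_nullSymbols μ)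
    simp only [total, map_add] at ht
    simp only [Pi.neg_apply, Pi.add_apply]
    linear_combination ht
  change π _ = 0
  simp only [map_add, map_defect]
  generalize (fun μ => π (mom₀ μ)) = k₀ at *
  generalize (fun μ => π (mom₁ μ)) = k₁ at *
  generalize (fun μ => π (mom₂ μ)) = k₂ at *
  generalize (fun μ => π (mom₃ μ)) = k₃ at *
  refine sum_defect _ _ _ _ _ _ _ _ hq h₁ h₂ h₃ ?_
  -- Masslessness of the ghost momentum `-(k₁ + k₂ + k₃)` gives twice the sum of the mixed products;
  -- the complex scalars allow dividing by 2.
  have hhalf : algebraMap ℂ (Symb4 ⧸ nullSymbols) (1 / 2) * 2 = 1 := by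
    rw [← map_ofNat (algebraMap ℂ (Symb4 ⧸ nullSymbols)) 2, ← map_mul]
    norm_num
  rw [hq] at h₀
  simp only [neg_dot, dot_neg, add_dot, dot_add, h₁, h₂, h₃, dot_comm k₂ k₁, dot_comm k₃ k₁,
    dot_comm k₃ k₂] at h₀
  linear_combination algebraMap ℂ (Symb4 ⧸ nullSymbols) (1 / 2) * h₀
    - (dot k₁ k₂ + dot k₁ k₃ + dot k₂ k₃) * hhalf

/-- All six permutations of the `h` slots have the same quantization, so `Y` may be replaced by its
average, whose symbol is null. -/
theorem defect_mem_divergences :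
    quantU 3 (defect pol₀ mom₀ pol₁ mom₁ pol₂ mom₂ pol₃ mom₃) ∈ divergences := by
  set Y : Symb4 := defect pol₀ mom₀ pol₁ mom₁ pol₂ mom₂ pol₃ mom₃ with hY
  have h12 : ∀ x, quantU 3 (swap₁₂ x) = quantU 3 x := quantU_swap₁₂ 3
  have h23 : ∀ x, quantU 3 (swap₂₃ x) = quantU 3 x := quantU_swap₂₃ 3
  have hsum : quantU 3 (Y + swap₂₃ Y + swap₁₂ Y + swap₁₂ (swap₂₃ Y) + swap₂₃ (swap₁₂ Y)
      + swap₁₂ (swap₂₃ (swap₁₂ Y))) ∈ divergences := by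
    refine quantU_mem_divergences ?_
    rw [hY]
    simp only [map_defect, swap₁₂_pol₀, swap₁₂_mom₀, swap₁₂_pol₁, swap₁₂_mom₁, swap₁₂_pol₂, swap₁₂_mom₂,
      swap₁₂_pol₃, swap₁₂_mom₃, swap₂₃_pol₀, swap₂₃_mom₀, swap₂₃_pol₁, swap₂₃_mom₁, swap₂₃_pol₂,
      swap₂₃_mom₂, swap₂₃_pol₃, swap₂₃_mom₃]
    exact sum_defect_mem_nullSymbols
  have h6 : quantU 3 Y = (1 / 6 : ℂ) • quantU 3 (Y + swap₂₃ Y + swap₁₂ Y + swap₁₂ (swap₂₃ Y)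
      + swap₂₃ (swap₁₂ Y) + swap₁₂ (swap₂₃ (swap₁₂ Y))) := by
    simp only [map_add, h12, h23]
    module
  rw [h6]
  exact Submodule.smul_mem _ _ hsum

end

/-! ### The removal of the anomaly -/

theorem quantHH_mem_typed (n : ℕ) (x : Symb2) : quantHH n x ∈ typed 2 0 0 (2 + n) := by
  refine linearMap_mem_of_mon ?_ x
  rintro ⟨a, b⟩
  rw [quantHH_mon]
  split_ifs with hn
  · have := mul_mem_typed (slotH_mem_typed a) (slotH_mem_typed b)
    have e4 : 1 + a.2.card + (1 + b.2.card) = 2 + n := by omega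
    rw [e4] at this
    exact this
  · exact Submodule.zero_mem _

theorem calD_mem_typed : calD ∈ typed 2 0 0 4 := by
  rw [calD_eq]
  exact quantHH_mem_typed 2 _

theorem calDD_mem_typed (μ ν : Fin 4) : calDD μ ν ∈ typed 2 0 0 4 := by
  rw [calDD_eq]
  exact quantHH_mem_typed 2 _

theorem h_mul_mem_typed (μ ν : Fin 4) {A : Jet} (hA : A ∈ typed 2 0 0 4) :
    h μ ν 0 * A ∈ typed 3 0 0 5 := by
  have := mul_mem_typed (h_mem_typed μ ν 0) hA
  simpa using this

theorem calA0_mem_typed : calA0 ∈ typed 3 0 0 5 := by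
  have htr : trh 0 * calD ∈ typed 3 0 0 5 := by
    have := mul_mem_typed (trh_mem_typed 0) calD_mem_typed
    simpa using this
  exact Submodule.add_mem _ (Submodule.smul_mem _ _ htr)
    (Submodule.smul_mem _ _ (Submodule.sum_mem _ fun μ _ => Submodule.sum_mem _ fun ν _ =>
      Submodule.smul_mem _ _ (h_mul_mem_typed μ ν (calDD_mem_typed μ ν))))

theorem calA2_mem_typed (μ ν : Fin 4) : calA2 μ ν ∈ typed 3 0 0 5 :=
  Submodule.add_mem _ (Submodule.smul_mem _ _ (h_mul_mem_typed μ ν calD_mem_typed))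
    (Submodule.smul_mem _ _ (Submodule.sum_mem _ fun l _ =>
      Submodule.smul_mem _ _ (h_mul_mem_typed ν l (calDD_mem_typed μ l))))

theorem u_mul_mem_typed (μ : Fin 4) {A : Jet} (hA : A ∈ typed 3 0 0 5) :
    u μ 0 * A ∈ typed 3 1 0 6 := by
  have := mul_mem_typed (u_mem_typed μ 0) hA
  simpa using this

/-- The current `u^ρ 𝒜 + u_μ 𝒜^{μρ}` which moves the derivatives of the ghosts in the anomaly. -/
def anomalyCurrent (ρ : Fin 4) : Jet :=
  g ρ • (u ρ 0 * calA0) + ∑ μ, (g μ * g ρ) • (u μ 0 * calA2 μ ρ)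

theorem anomalyCurrent_mem_typed (ρ : Fin 4) : anomalyCurrent ρ ∈ typed 3 1 0 6 :=
  Submodule.add_mem _ (Submodule.smul_mem _ _ (u_mul_mem_typed ρ calA0_mem_typed))
    (Submodule.sum_mem _ fun μ _ => Submodule.smul_mem _ _
      (u_mul_mem_typed μ (calA2_mem_typed μ ρ)))

/-- The Leibniz rule, read backwards, moves the derivatives from the ghosts to `𝒜` and `𝒜_{μν}`. -/
theorem anomalyForm_eq_add_divergence :
    (∑ ρ, g ρ • (u ρ 0 * calA1 ρ)) + (∑ ρ, g ρ • (u ρ {ρ} * calA0))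
      + ∑ μ, ∑ ν, (g μ * g ν) • (u μ {ν} * calA2 μ ν) =
    (∑ ρ, g ρ • (u ρ 0 * calAtilde ρ)) + ∑ ρ, d ρ (anomalyCurrent ρ) := by
  have e₁ : ∑ ρ, g ρ • (u ρ 0 * calAtilde ρ) = (∑ ρ, g ρ • (u ρ 0 * calA1 ρ))
      - (∑ ρ, g ρ • (u ρ 0 * d ρ calA0))
      - ∑ μ, ∑ ν, (g μ * g ν) • (u μ 0 * d ν (calA2 μ ν)) := by
    simp only [calAtilde, mul_sub, smul_sub, Finset.sum_sub_distrib, Finset.mul_sum,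
      Finset.smul_sum, mul_smul_comm, smul_smul]
  have e₂ : ∑ ρ, d ρ (anomalyCurrent ρ) =
      (∑ ρ, g ρ • (u ρ {ρ} * calA0)) + (∑ ρ, g ρ • (u ρ 0 * d ρ calA0))
      + ((∑ μ, ∑ ν, (g μ * g ν) • (u μ {ν} * calA2 μ ν))
        + ∑ μ, ∑ ν, (g μ * g ν) • (u μ 0 * d ν (calA2 μ ν))) := by
    simp only [anomalyCurrent, map_add, map_sum, map_smul, d_mul, d_u, smul_add,
      Finset.sum_add_distrib, Multiset.cons_zero]
    rw [Finset.sum_comm (f := fun ν μ => (g μ * g ν) • (u μ {ν} * calA2 μ ν)),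
      Finset.sum_comm (f := fun ν μ => (g μ * g ν) • (u μ 0 * d ν (calA2 μ ν)))]
  rw [e₁, e₂]
  abel

open Symb4 in
/-- `d_Q N₀` is on shell `i` times the anomaly, up to a divergence. -/
theorem dQ_N0_sub_mem_divergences :
    dQ N0 - Complex.I • ghostContraction (fun μ ν => calDD μ ν + η μ ν • calD) ∈ divergences := by
  have e : dQ N0 - Complex.I • ghostContraction (fun μ ν => calDD μ ν + η μ ν • calD) =
      (-(Complex.I / 2)) • quantU 3 (defect pol₀ mom₀ pol₁ mom₁ pol₂ mom₂ pol₃ mom₃) := by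
    have h2 : (2 : Symb4) = algebraMap ℂ Symb4 2 := by rw [map_ofNat]
    rw [dQ_N0, ghostContraction_calD, defect, h2, ← Algebra.smul_def, map_add, map_smul]
    module
  rw [e]
  exact Submodule.smul_mem _ _ defect_mem_divergences

/-- When both currents agree, the derivatives of `δ` with respect to the two points cancel, and only
`δ` times the divergence is left. -/
theorem delta_add_sR_delta (A N : Jet) (K : Fin 4 → Jet) :
    delta A + sR (delta N) (fun μ => delta (K μ)) (fun μ => delta (K μ)) =
      delta (A + dQ N - Complex.I • ∑ μ, d μ (K μ)) := by
  have h₁ : ∀ μ, partial1 μ (delta (K μ)) + partial2 μ (delta (K μ)) = delta (d μ (K μ)) := by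
    intro μ
    simp [partial1, partial2, delta, Finsupp.mapDomain_single, Finsupp.mapRange_single]
    abel
  have h₂ : sR (delta N) (fun μ => delta (K μ)) (fun μ => delta (K μ)) =
      delta (dQ N) - Complex.I • ∑ μ, delta (d μ (K μ)) := by
    have h₃ : (delta N).mapRange dQ (map_zero _) = delta (dQ N) := Finsupp.mapRange_single
    rw [sR, h₃]
    simp only [← h₁, Finset.sum_add_distrib, smul_add]
    abel
  rw [h₂]
  simp only [delta, Finsupp.single_sub, Finsupp.single_add, ← Finsupp.smul_single,
    ← Finsupp.single_finsetSum]
  abel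

end QGrav

end

/-! ### The theorem -/

theorem mainTheorem4 :
    -- the form of the anomaly: `A_{uhhh} = u_ρ 𝒜^ρ + u_{ρ,}^ρ 𝒜 + u_{μ,ν} 𝒜^{μν}` on shell
    OnShellEq anomalyUHHH
      ((∑ ρ, g ρ • (u ρ 0 * calA1 ρ)) + (∑ ρ, g ρ • (u ρ {ρ} * calA0))
        + ∑ μ, ∑ ν, (g μ * g ν) • (u μ {ν} * calA2 μ ν)) ∧
    -- `N(T,T)` is quadri-linear in `h`, of ghost number 0 and canonical dimension 6
    HasType 4 0 0 6 NTT ∧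
    -- `R(T,T) = δ N(T,T)`, completed by `R(T^μ,T) = δ N(T^μ,T)` and `R(T,T^μ) = δ N(T,T^μ)`,
    -- removes the anomaly `δ A_{uhhh}`
    (∃ N1 N2 : Fin 4 → Jet,
      (∀ μ, N1 μ = N2 μ) ∧
      (∀ μ, HasType 3 1 0 6 (N1 μ)) ∧
      VanishesOnShell
        (delta anomalyUHHH + sR (delta NTT) (fun μ => delta (N1 μ)) (fun μ => delta (N2 μ)))) ∧
    -- `d_Q N₀ = i (u_ρ 𝒜̃^ρ + d_ρ K^ρ)` on shell, where `N(T,T) = i N₀`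
    (∃ K : Fin 4 → Jet,
      (∀ ρ, HasType 3 1 0 6 (K ρ)) ∧
      OnShellEq (dQ N0)
        (Complex.I • ((∑ ρ, g ρ • (u ρ 0 * calAtilde ρ)) + ∑ ρ, d ρ (K ρ)))) := by

  have anomaly_onShell := anomalyUHHH_onShell
  obtain ⟨K, hK, hd⟩ := dQ_N0_sub_mem_divergences
  refine ⟨?_, mem_typed.1 (Submodule.smul_mem _ _ N0_mem_typed),
    -- The current of the on-shell identity for `d_Q N₀` is used for both arguments. In the last
    -- claim `K` is multiplied by `-i`, undoing the outer factor `i`, and `anomalyCurrent` absorbs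
    -- the derivatives of the ghosts.
    ⟨K, K, fun _ => rfl, fun μ => mem_typed.1 (hK μ), ?_⟩,
    ⟨fun ρ => anomalyCurrent ρ + (-Complex.I) • K ρ, fun ρ => mem_typed.1
      (Submodule.add_mem _ (anomalyCurrent_mem_typed ρ) (Submodule.smul_mem _ _ (hK ρ))), ?_⟩⟩
  · rw [anomalyForm_eq]
    exact anomaly_onShell
  · intro s
    rw [delta_add_sR_delta, OnShellEq, sub_zero, delta, Finsupp.single_apply]
    split_ifs
    · rw [← mem_eomSubmodule, NTT, map_smul]
      -- Multiplying by `i` turns `-i` times the contracted anomaly into the contracted anomaly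
      -- itself, which cancels against the first relation.
      convert Submodule.add_mem _ anomaly_onShell (Submodule.smul_mem _ Complex.I hd) using 1
      simp only [smul_sub, smul_smul, Complex.I_mul_I]
      module
    · exact eom.zero_mem
  · rw [OnShellEq, ← mem_eomSubmodule]
    convert hd using 1
    rw [← anomalyForm_eq, anomalyForm_eq_add_divergence]
    simp only [map_add, map_smul, Finset.sum_add_distrib, ← Finset.smul_sum, smul_add, smul_smul,
      mul_neg, Complex.I_mul_I, neg_neg, one_smul]
    abel
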